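/- Let $n\ge 1$ and let $c=(c_{ij})_{i,j\in[n]}$ have positive entries. On $\mathbb R^{n^2}$ put $\langle x,y\rangle_c=\sum_{ij}c_{ij}x_{ij}y_{ij}$ and $\|x\|_c^2=\langle x,x\rangle_c$. Consider an $n\times n$ input-queued switch in slotted time with queue lengths $Q(t)\in\mathbb Z_+^{n^2}$ satisfying $$Q(t+1)=Q(t)+A(t)-S(t)+U(t),$$ where the arrivals $A_{ij}(t)\in\mathbb Z_+$ are independent over $(i,j)$ and $t$ and identically distributed over $t$; $S(t)$ is chosen by $c$-weighted MaxWeight, i.e. uniformly at random among the maximizers of $\langle Q(t),s\rangle_c$ over all $n\times n$ permutation matrices $s$; and $U_{ij}(t)=\max(S_{ij}(t)-Q_{ij}(t)-A_{ij}(t),0)$ is the unused service. Let $\mathcal F$ be the set of nonnegative $n\times n$ matrices with all row sums and all column sums equal to $1$ (all ports saturated), and let $\nu$ be in the relative interior of $\mathcal F$. For each $0<\epsilon<1$ consider such a switch whose arrivals $A^{(\epsilon)}$ have mean $\mathbb E[A^{(\epsilon)}_{ij}(t)]=(1-\epsilon)\nu_{ij}$ and are bounded by a constant $A_{\max}$ not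 depending on $\epsilon$, and suppose that $\operatorname{Var}(A^{(\epsilon)}_{ij}(t))\to\sigma_{ij}^2$ as $\epsilon\downarrow0$ for all $i,j$. Let $\overline Q^{(\epsilon)}$ be a steady-state queue-length vector, i.e. a limit in distribution of the queue-length process as $t\to\infty$. Then $\mathbb E\big[\sum_{ij}c_{ij}\overline Q^{(\epsilon)}_{ij}\big]<\infty$ for every $0<\epsilon<1$, and $$\lim_{\epsilon\downarrow0}\ \epsilon\,\mathbb E\Big[\sum_{ij}c_{ij}\overline Q^{(\epsilon)}_{ij}\Big]=\frac n2\sum_{ij}\sigma_{ij}^2\,\zeta_{ij},\qquad \zeta_{ij}=\big\|(e_{ij})_{\parallel\mathcal S_c}\big\|_c^2 ,$$ where $e_{ij}$ is the matrix with $1$ in position $(i,j)$ and $0$ elsewhere, and $(\cdot)_{\parallel\mathcal S_c}$ is the $\langle\cdot,\cdot\rangle_c$-orthogonal projection onto $\mathcal S_c=\{x\in\mathbb R^{n^2}: x_{ij}=(w_i+\tilde w_j)/c_{ij}\text{ for some }w,\tilde w\in\mathbb R^n\}$. -/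

import Mathlib

open Set Filter Topology MeasureTheory ProbabilityTheory

namespace InputQueuedSwitch

noncomputable section

/-- Vectors of `ℝ^{n²}`, indexed by the queues `(i, j)`. -/
abbrev Vec (n : ℕ) : Type := Fin n × Fin n → ℝ

/-- Integer vectors indexed by the queues: queue lengths, arrivals, schedules, unused service. -/
abbrev IVec (n : ℕ) : Type := Fin n × Fin n → ℕ

variable {n : ℕ}

/-- An integer vector seen as a real vector. -/
def IVec.toReal (q : IVec n) : Vec n := fun p => (q p : ℝ)

/-! ### The weighted inner product and the geometry of the saturated face -/

/-- The weighted inner product `⟨x, y⟩_c = ∑ c_ij x_ij y_ij`. -/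
def cInner (c x y : Vec n) : ℝ := ∑ p, c p * x p * y p

/-- The squared weighted norm `‖x‖_c² = ⟨x, x⟩_c`. -/
def cNormSq (c x : Vec n) : ℝ := cInner c x x

/-- The vector with entries `1 / c_ij` in row `i` and zero in the other rows. -/
def rowVec (c : Vec n) (i : Fin n) : Vec n := fun p => if p.1 = i then 1 / c p else 0

/-- The vector with entries `1 / c_ij` in column `j` and zero in the other columns. -/
def colVec (c : Vec n) (j : Fin n) : Vec n := fun p => if p.2 = j then 1 / c p else 0

/-- The face of the capacity region on which all input and output ports are saturated. -/
def face (c : Vec n) : Set (Vec n) :=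
  {r | (∀ p, 0 ≤ r p) ∧ (∀ i, cInner c r (rowVec c i) = 1) ∧ ∀ j, cInner c r (colVec c j) = 1}

/-- The subspace `S_c` of the vectors `x` with `x_ij = (w_i + w'_j) / c_ij`. -/
def spaceS (c : Vec n) : Submodule ℝ (Vec n) where
  carrier := {x | ∃ w w' : Fin n → ℝ, ∀ i j, x (i, j) = (w i + w' j) / c (i, j)}
  zero_mem' := ⟨0, 0, fun i j => by simp⟩
  add_mem' := by
    rintro x y ⟨w, w', hx⟩ ⟨v, v', hy⟩
    refine ⟨w + v, w' + v', fun i j => ?_⟩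
    simp only [Pi.add_apply, hx, hy]
    ring
  smul_mem' := by
    rintro a x ⟨w, w', hx⟩
    refine ⟨a • w, a • w', fun i j => ?_⟩
    simp only [Pi.smul_apply, smul_eq_mul, hx]
    ring

/-- The weighted inner product as a bilinear form. -/
def cForm (c : Vec n) : LinearMap.BilinForm ℝ (Vec n) :=
  LinearMap.mk₂ ℝ (cInner c)
    (fun x y z => by
      simp only [cInner, Pi.add_apply, ← Finset.sum_add_distrib]
      exact Finset.sum_congr rfl fun p _ => by ring)
    (fun a x y => by
      simp only [cInner, Pi.smul_apply, smul_eq_mul, Finset.mul_sum]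
      exact Finset.sum_congr rfl fun p _ => by ring)
    (fun x y z => by
      simp only [cInner, Pi.add_apply, ← Finset.sum_add_distrib]
      exact Finset.sum_congr rfl fun p _ => by ring)
    (fun a x y => by
      simp only [cInner, Pi.smul_apply, smul_eq_mul, Finset.mul_sum]
      exact Finset.sum_congr rfl fun p _ => by ring)

theorem cInner_comm (c x y : Vec n) : cInner c x y = cInner c y x :=
  Finset.sum_congr rfl fun p _ => by ring

theorem eq_zero_of_cNormSq {c : Vec n} (hc : ∀ p, 0 < c p) {x : Vec n}
    (hx : cInner c x x = 0) : x = 0 := by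
  have h0 : ∀ p ∈ Finset.univ, 0 ≤ c p * x p * x p := fun p _ => by
    have := mul_nonneg (hc p).le (mul_self_nonneg (x p))
    linarith [mul_assoc (c p) (x p) (x p)]
  funext p
  have h1 := (Finset.sum_eq_zero_iff_of_nonneg h0).1 hx p (Finset.mem_univ p)
  have h2 : c p ≠ 0 := (hc p).ne'
  simpa [h2] using h1

/-- Existence of the orthogonal projection onto `S_c` for the weighted inner product. -/
theorem exists_cProj {c : Vec n} (hc : ∀ p, 0 < c p) (x : Vec n) :
    ∃ y ∈ spaceS c, ∀ z ∈ spaceS c, cInner c (x - y) z = 0 := by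
  have hrefl : (cForm c).IsRefl := fun u v h => (cInner_comm c v u).trans h
  have hdisj : Disjoint (spaceS c) ((cForm c).orthogonal (spaceS c)) := by
    rw [Submodule.disjoint_def]
    intro u hu hu'
    exact eq_zero_of_cNormSq hc (hu' u hu)
  have hcompl := LinearMap.BilinForm.isCompl_orthogonal_of_restrict_nondegenerate hrefl
    (LinearMap.BilinForm.nondegenerate_restrict_of_disjoint_orthogonal (cForm c) hrefl hdisj)
  obtain ⟨y, hy, v, hv, hyv⟩ := Submodule.mem_sup.1
    (hcompl.sup_eq_top ▸ Submodule.mem_top : x ∈ spaceS c ⊔ (cForm c).orthogonal (spaceS c))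
  refine ⟨y, hy, fun z hz => ?_⟩
  have h1 : x - y = v := by rw [← hyv]; simp
  rw [h1, cInner_comm]
  exact hv z hz

/-- The projection of `x` onto `S_c`, orthogonal for the weighted inner product. -/
def cProj (c : Vec n) (hc : ∀ p, 0 < c p) (x : Vec n) : Vec n := (exists_cProj hc x).choose

/-- `ζ_ij = ‖(e_ij)_{∥ S_c}‖_c²`, where `e_ij` has a `1` in position `(i, j)` and zeros
elsewhere. -/
def zeta (c : Vec n) (hc : ∀ p, 0 < c p) : Vec n :=
  fun p => cNormSq c (cProj c hc (Pi.single p 1))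

/-! ### Schedules and weighted MaxWeight -/

/-- The maximal schedules: zero-one vectors with all row sums and all column sums equal to `1`. -/
def schedules (n : ℕ) : Finset (IVec n) :=
  {s ∈ Fintype.piFinset fun _ : Fin n × Fin n => ({0, 1} : Finset ℕ) |
    (∀ i, ∑ j, s (i, j) = 1) ∧ ∀ j, ∑ i, s (i, j) = 1}

open scoped Classical in
/-- The schedules of maximal weight `⟨q, s⟩_c` when the queue lengths are `q`. -/
def maxWeight (c : Vec n) (q : IVec n) : Finset (IVec n) :=
  {s ∈ schedules n | ∀ s' ∈ schedules n, cInner c q.toReal s'.toReal ≤ cInner c q.toReal s.toReal}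

theorem schedules_nonempty (n : ℕ) : (schedules n).Nonempty := by
  refine ⟨fun p => if p.1 = p.2 then 1 else 0, ?_⟩
  simp only [schedules, Finset.mem_filter, Fintype.mem_piFinset]
  refine ⟨fun p => ?_, fun i => by simp, fun j => by simp⟩
  by_cases h : p.1 = p.2 <;> simp [h]

theorem maxWeight_nonempty (c : Vec n) (q : IVec n) : (maxWeight c q).Nonempty := by
  obtain ⟨s, hs, hmax⟩ := Finset.exists_max_image (schedules n)
    (fun s => cInner c q.toReal s.toReal) (schedules_nonempty n)
  exact ⟨s, by classical exact Finset.mem_filter.2 ⟨hs, hmax⟩⟩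

/-! ### Queueing dynamics -/

/-- The unused service `u_ij = max (s_ij - q_ij - a_ij, 0)` for queue lengths `q`, arrivals `a`
and schedule `s` (truncated subtraction of natural numbers). -/
def unused (q a s : IVec n) : IVec n := fun p => s p - (q p + a p)

/-- The next queue lengths `q + a - s + u`; the subtraction never truncates, see `next_add`. -/
def next (q a s : IVec n) : IVec n := fun p => q p + a p + unused q a s p - s p

theorem next_add (q a s : IVec n) (p : Fin n × Fin n) :
    next q a s p + s p = q p + a p + unused q a s p := by
  simp only [next, unused]
  omega

/-- Service is unused only at queues that end the slot empty. -/
theorem next_mul_unused (q a s : IVec n) (p : Fin n × Fin n) :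
    next q a s p * unused q a s p = 0 := by
  simp only [next, unused, mul_eq_zero]
  omega

/-- The law of the arrival vector of one time slot: independent coordinates, the coordinate
`(i, j)` having the law `α (i, j)`. -/
def arrivals (α : Fin n × Fin n → PMF ℕ) : PMF (IVec n) :=
  (Measure.pi fun p => (α p).toMeasure).toPMF

/-- The transition law of the queue-length Markov chain under weighted MaxWeight: the schedule is
uniform on the schedules of maximal weight and the arrivals are independent of everything else. -/
def step (c : Vec n) (α : Fin n × Fin n → PMF ℕ) (q : IVec n) : PMF (IVec n) :=
  (PMF.uniformOfFinset (maxWeight c q) (maxWeight_nonempty c q)).bind fun s =>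
    (arrivals α).map fun a => next q a s

/-- The law of the queue-length vector at time `t`, for the initial law `μ`. -/
def lawAt (c : Vec n) (α : Fin n × Fin n → PMF ℕ) (μ : PMF (IVec n)) : ℕ → PMF (IVec n)
  | 0 => μ
  | t + 1 => (lawAt c α μ t).bind (step c α)

/-- `π` is a steady-state law: for some initial law the queue-length vector at time `t` converges
in distribution to `π` as `t → ∞`. (On a countable discrete space, convergence in distribution to
a probability law is convergence of the point masses. A stationary law is a steady-state law: take
it as initial law.) -/
def IsSteadyState (c : Vec n) (α : Fin n × Fin n → PMF ℕ) (π : PMF (IVec n)) : Prop :=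
  ∃ μ : PMF (IVec n), ∀ q, Tendsto (fun t => lawAt c α μ t q) atTop (𝓝 (π q))

/-- The mean of a law on `ℕ`. -/
def mean (β : PMF ℕ) : ℝ := ∫ k, (k : ℝ) ∂β.toMeasure

/-- The variance of a law on `ℕ`. -/
def var (β : PMF ℕ) : ℝ := Var[fun k : ℕ => (k : ℝ); β.toMeasure]

/-- The weighted sum of queue lengths `∑ c_ij q_ij`. -/
def cost (c : Vec n) (q : IVec n) : ℝ := ∑ p, c p * (q p : ℝ)

/-- The base family of switches: for each `0 < ε < 1` the arrivals to queue `(i, j)` in a slot have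
law `A ε (i, j)`, with mean `(1 - ε) ν_ij`, where `ν` is in the relative interior of the face, and
at most `Amax` arrivals; the variances converge to `σ2` as `ε ↓ 0`. -/
structure IsBaseFamily (c ν : Vec n) (Amax : ℕ) (A : ℝ → Fin n × Fin n → PMF ℕ) (σ2 : Vec n) :
    Prop where
  mem_face : ν ∈ intrinsicInterior ℝ (face c)
  mean_eq : ∀ ε ∈ Ioo (0 : ℝ) 1, ∀ p, mean (A ε p) = (1 - ε) * ν p
  bounded : ∀ ε ∈ Ioo (0 : ℝ) 1, ∀ p, ∀ k ∈ (A ε p).support, k ≤ Amax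
  var_tendsto : ∀ p, Tendsto (fun ε => var (A ε p)) (𝓝[>] 0) (𝓝 (σ2 p))

end

end InputQueuedSwitch

/-!
The squared length of the projection of the queue vector `Q` onto `S_c` has zero drift in steady
state. One slot changes `Q` by `A - S + U`. The service `S` lies in the face `F`, and so does `ν`;
since differences of points of `F` are orthogonal to `S_c`, the mean of `A - S` projects to
`-ε ν_∥`, and `⟨Q_∥, ν⟩_c = ⟨Q_∥, 1 / n⟩_c` is the projected cost divided by `n`. Thus the linear
part of the drift is `-(2 ε / n) E[cost]`, the quadratic part is the sum of the variances weighted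
by `ζ`, and what is left (`abs_drift_cProj_le`) involves only the unused service `U`, of mean `ε n`
in total, and the component of `Q` orthogonal to `S_c`. As `Q` and `U` after a slot have disjoint
supports, `⟨Q_∥, U⟩_c = -⟨Q_⊥, U⟩_c`, which is `O(√ε)` in mean as soon as `E ‖Q_⊥‖_c²` is bounded
uniformly in `ε` (`abs_sum_var_sub_le`).

That bound is the state-space collapse (`exists_integral_coneDist_le`). The Lyapunov function is the
squared distance to the cone of nonnegative vectors of `S_c`: unused service cannot increase the
distance to a nonnegative point (`cNormSq_next_sub_le`). MaxWeight maximizes the weight over the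
whole face by Birkhoff's theorem, and `ν` has positive entries, so it can be moved inside the face
in the direction `Q_⊥`; this gives a drift of order `-‖Q_⊥‖_c` (`exists_cInner_sub_le`), and for
nonnegative vectors the distance to the cone and the distance to its span are comparable
(`exists_coneDist_le`). The squared norm of `Q` has a negative drift for every `ε` in `(0, 1)`, which
gives finite second moments (`integrable_cNormSq`).

In both cases the drift is turned into a steady-state moment bound by `integral_le_of_drift`. It
uses only that the limit law is stationary (`IsSteadyState.bind_step`) and truncates the square of
the Lyapunov function, so no moment has to be finite beforehand.
-/

namespace InputQueuedSwitch

variable {n : ℕ} {c ν x y z : Vec n}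

/-! ### The weighted inner product -/

theorem cInner_add_left (c x y z : Vec n) : cInner c (x + y) z = cInner c x z + cInner c y z :=
  LinearMap.BilinForm.add_left (B := cForm c) x y z

theorem cInner_add_right (c x y z : Vec n) : cInner c x (y + z) = cInner c x y + cInner c x z :=
  LinearMap.BilinForm.add_right (B := cForm c) x y z

theorem cInner_sub_left (c x y z : Vec n) : cInner c (x - y) z = cInner c x z - cInner c y z :=
  LinearMap.BilinForm.sub_left (B₁ := cForm c) x y z

theorem cInner_sub_right (c x y z : Vec n) : cInner c x (y - z) = cInner c x y - cInner c x z :=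
  LinearMap.BilinForm.sub_right (B₁ := cForm c) x y z

theorem cInner_smul_left (c : Vec n) (a : ℝ) (x y : Vec n) :
    cInner c (a • x) y = a * cInner c x y :=
  LinearMap.BilinForm.smul_left (B := cForm c) a x y

theorem cInner_smul_right (c : Vec n) (a : ℝ) (x y : Vec n) :
    cInner c x (a • y) = a * cInner c x y :=
  LinearMap.BilinForm.smul_right (B := cForm c) a x y

theorem cNormSq_add (c x y : Vec n) :
    cNormSq c (x + y) = cNormSq c x + 2 * cInner c x y + cNormSq c y := by
  simp only [cNormSq, cInner_add_left, cInner_add_right, cInner_comm c y x]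
  ring

theorem cNormSq_sub (c x y : Vec n) :
    cNormSq c (x - y) = cNormSq c x - 2 * cInner c x y + cNormSq c y := by
  simp only [cNormSq, cInner_sub_left, cInner_sub_right, cInner_comm c y x]
  ring

theorem cNormSq_smul (c : Vec n) (a : ℝ) (x : Vec n) :
    cNormSq c (a • x) = a ^ 2 * cNormSq c x := by
  simp only [cNormSq, cInner_smul_left, cInner_smul_right]
  ring

theorem cNormSq_eq_sum (c x : Vec n) : cNormSq c x = ∑ p, c p * x p ^ 2 :=
  Finset.sum_congr rfl fun p _ => by ring

theorem cNormSq_nonneg (hc : ∀ p, 0 < c p) (x : Vec n) : 0 ≤ cNormSq c x := by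
  rw [cNormSq_eq_sum]
  exact Finset.sum_nonneg fun p _ => mul_nonneg (hc p).le (sq_nonneg _)

theorem mul_sq_le_cNormSq (hc : ∀ p, 0 < c p) (x : Vec n) (p : Fin n × Fin n) :
    c p * x p ^ 2 ≤ cNormSq c x := by
  rw [cNormSq_eq_sum]
  exact Finset.single_le_sum (f := fun p => c p * x p ^ 2)
    (fun p _ => mul_nonneg (hc p).le (sq_nonneg _)) (Finset.mem_univ p)

/-- The Cauchy–Schwarz inequality for the weighted inner product. -/
theorem abs_cInner_le (hc : ∀ p, 0 < c p) (x y : Vec n) :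
    |cInner c x y| ≤ √(cNormSq c x) * √(cNormSq c y) := by
  rw [← Real.sqrt_mul (cNormSq_nonneg hc x), ← Real.sqrt_sq_eq_abs]
  apply Real.sqrt_le_sqrt
  have h := Finset.sum_mul_sq_le_sq_mul_sq Finset.univ
    (fun p => √(c p) * x p) (fun p => √(c p) * y p)
  have e : ∀ p, √(c p) ^ 2 = c p := fun p => Real.sq_sqrt (hc p).le
  have e1 : ∀ x : Vec n, ∑ p, (√(c p) * x p) ^ 2 = cNormSq c x := fun x => by
    rw [cNormSq_eq_sum]
    exact Finset.sum_congr rfl fun p _ => by rw [mul_pow, e]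
  have e2 : ∑ p, √(c p) * x p * (√(c p) * y p) = cInner c x y :=
    Finset.sum_congr rfl fun p _ => by linear_combination (x p * y p) * e p
  rwa [e1, e1, e2] at h

/-- A weighted form of Young's inequality. -/
theorem two_mul_abs_cInner_le (hc : ∀ p, 0 < c p) (x y : Vec n) {t : ℝ} (ht : 0 < t) :
    2 * |cInner c x y| ≤ t * cNormSq c x + cNormSq c y / t := by
  have h := abs_cInner_le hc x y
  have e1 := Real.sq_sqrt (cNormSq_nonneg hc x)
  have e2 := Real.sq_sqrt (cNormSq_nonneg hc y)
  set a := √(cNormSq c x)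
  set b := √(cNormSq c y)
  rw [← e1, ← e2]
  have h2 : 0 ≤ (t * a - b) ^ 2 / t := by positivity
  have h3 : (t * a - b) ^ 2 / t = t * a ^ 2 + b ^ 2 / t - 2 * (a * b) := by
    field_simp
    ring
  linarith

theorem cNormSq_add_le (hc : ∀ p, 0 < c p) (x y : Vec n) :
    cNormSq c (x + y) ≤ 2 * cNormSq c x + 2 * cNormSq c y := by
  have h1 := cNormSq_nonneg hc (x - y)
  rw [cNormSq_sub] at h1
  rw [cNormSq_add]
  linarith

theorem cNormSq_le_of_abs_le (hc : ∀ p, 0 < c p) {M : ℝ} (h : ∀ p, |x p| ≤ M) :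
    cNormSq c x ≤ M ^ 2 * ∑ p, c p := by
  rw [cNormSq_eq_sum, Finset.mul_sum]
  refine Finset.sum_le_sum fun p _ => ?_
  have h1 : x p ^ 2 ≤ M ^ 2 := sq_le_sq' (neg_le_of_abs_le (h p)) (le_of_abs_le (h p))
  nlinarith [hc p]

/-! ### The subspace `S_c` and the projection onto it -/

theorem rowVec_mem (c : Vec n) (i : Fin n) : rowVec c i ∈ spaceS c := by
  refine ⟨Pi.single i 1, 0, fun k j => ?_⟩
  by_cases h : k = i <;> simp [rowVec, h]

theorem colVec_mem (c : Vec n) (j : Fin n) : colVec c j ∈ spaceS c := by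
  refine ⟨0, Pi.single j 1, fun k l => ?_⟩
  by_cases h : l = j <;> simp [colVec, h]

theorem one_div_mem (c : Vec n) : (fun p => 1 / c p) ∈ spaceS c :=
  ⟨1, 0, fun i j => by simp⟩

theorem cInner_rowVec (hc : ∀ p, 0 < c p) (x : Vec n) (i : Fin n) :
    cInner c x (rowVec c i) = ∑ j, x (i, j) := by
  rw [cInner, Fintype.sum_prod_type, Finset.sum_eq_single i]
  · refine Finset.sum_congr rfl fun j _ => ?_
    have := (hc (i, j)).ne'
    simp only [rowVec, if_true]
    field_simp
  · intro k _ hk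
    simp [rowVec, hk]
  · simp

theorem cInner_colVec (hc : ∀ p, 0 < c p) (x : Vec n) (j : Fin n) :
    cInner c x (colVec c j) = ∑ i, x (i, j) := by
  rw [cInner, Fintype.sum_prod_type_right, Finset.sum_eq_single j]
  · refine Finset.sum_congr rfl fun i _ => ?_
    have := (hc (i, j)).ne'
    simp only [colVec, if_true]
    field_simp
  · intro k _ hk
    simp [colVec, hk]
  · simp

theorem cInner_of_mem_spaceS (hc : ∀ p, 0 < c p) (x : Vec n) (w w' : Fin n → ℝ)
    (hz : ∀ i j, z (i, j) = (w i + w' j) / c (i, j)) :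
    cInner c x z = ∑ i, w i * ∑ j, x (i, j) + ∑ j, w' j * ∑ i, x (i, j) := by
  simp only [Finset.mul_sum]
  rw [Finset.sum_comm (f := fun j i => w' j * x (i, j)), ← Finset.sum_add_distrib, cInner,
    Fintype.sum_prod_type]
  refine Finset.sum_congr rfl fun i _ => ?_
  rw [← Finset.sum_add_distrib]
  refine Finset.sum_congr rfl fun j _ => ?_
  have := (hc (i, j)).ne'
  rw [hz]
  field_simp

theorem mem_face_iff (hc : ∀ p, 0 < c p) : x ∈ face c ↔
    (∀ p, 0 ≤ x p) ∧ (∀ i, ∑ j, x (i, j) = 1) ∧ ∀ j, ∑ i, x (i, j) = 1 := by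
  simp only [face, Set.mem_ofPred_eq, cInner_rowVec hc, cInner_colVec hc]

/-- All points of the face have the same inner product with a vector of `S_c`: the face is
orthogonal to `S_c`. -/
theorem cInner_eq_of_mem_face (hc : ∀ p, 0 < c p) (hx : x ∈ face c) (hy : y ∈ face c)
    (hz : z ∈ spaceS c) : cInner c x z = cInner c y z := by
  obtain ⟨w, w', h⟩ := hz
  rw [mem_face_iff hc] at hx hy
  simp only [cInner_of_mem_spaceS hc _ w w' h, hx.2.1, hx.2.2, hy.2.1, hy.2.2]

theorem cProj_mem (hc : ∀ p, 0 < c p) (x : Vec n) : cProj c hc x ∈ spaceS c :=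
  (exists_cProj hc x).choose_spec.1

theorem cInner_sub_cProj (hc : ∀ p, 0 < c p) (x : Vec n) (hz : z ∈ spaceS c) :
    cInner c (x - cProj c hc x) z = 0 :=
  (exists_cProj hc x).choose_spec.2 z hz

theorem cInner_cProj_left (hc : ∀ p, 0 < c p) (x : Vec n) (hz : z ∈ spaceS c) :
    cInner c (cProj c hc x) z = cInner c x z := by
  have h := cInner_sub_cProj hc x hz
  rw [cInner_sub_left] at h
  linarith

theorem cProj_unique (hc : ∀ p, 0 < c p) (hy : y ∈ spaceS c)
    (h : ∀ z ∈ spaceS c, cInner c (x - y) z = 0) : cProj c hc x = y := by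
  refine sub_eq_zero.1 (eq_zero_of_cNormSq hc ?_)
  have hm : cProj c hc x - y ∈ spaceS c := (spaceS c).sub_mem (cProj_mem hc x) hy
  have h1 := h _ hm
  rw [cInner_sub_left] at h1 ⊢
  rw [cInner_cProj_left hc x hm]
  exact h1

/-- The projection onto `S_c` as a linear map. -/
noncomputable def cProjₗ (c : Vec n) (hc : ∀ p, 0 < c p) : Vec n →ₗ[ℝ] Vec n where
  toFun := cProj c hc
  map_add' x y := cProj_unique hc ((spaceS c).add_mem (cProj_mem hc x) (cProj_mem hc y))
    fun z hz => by
      rw [cInner_sub_left, cInner_add_left, cInner_add_left, cInner_cProj_left hc _ hz,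
        cInner_cProj_left hc _ hz, sub_self]
  map_smul' a x := cProj_unique hc ((spaceS c).smul_mem _ (cProj_mem hc x))
    fun z hz => by
      rw [cInner_sub_left, cInner_smul_left, RingHom.id_apply, cInner_smul_left,
        cInner_cProj_left hc _ hz, sub_self]

theorem cProj_add (hc : ∀ p, 0 < c p) (x y : Vec n) :
    cProj c hc (x + y) = cProj c hc x + cProj c hc y := (cProjₗ c hc).map_add x y

theorem cProj_sub (hc : ∀ p, 0 < c p) (x y : Vec n) :
    cProj c hc (x - y) = cProj c hc x - cProj c hc y := (cProjₗ c hc).map_sub x y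

theorem cProj_smul (hc : ∀ p, 0 < c p) (a : ℝ) (x : Vec n) :
    cProj c hc (a • x) = a • cProj c hc x := (cProjₗ c hc).map_smul a x

theorem cNormSq_sub_of_mem (hc : ∀ p, 0 < c p) (x : Vec n) (hy : y ∈ spaceS c) :
    cNormSq c (x - y) = cNormSq c (x - cProj c hc x) + cNormSq c (cProj c hc x - y) := by
  have h : x - y = (x - cProj c hc x) + (cProj c hc x - y) := by abel
  rw [h, cNormSq_add,
    cInner_sub_cProj hc x ((spaceS c).sub_mem (cProj_mem hc x) hy)]
  ring

theorem cNormSq_eq_add_cProj (hc : ∀ p, 0 < c p) (x : Vec n) :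
    cNormSq c x = cNormSq c (x - cProj c hc x) + cNormSq c (cProj c hc x) := by
  simpa using cNormSq_sub_of_mem hc x (spaceS c).zero_mem

theorem cNormSq_cProj_le (hc : ∀ p, 0 < c p) (x : Vec n) :
    cNormSq c (cProj c hc x) ≤ cNormSq c x := by
  linarith [cNormSq_eq_add_cProj hc x, cNormSq_nonneg hc (x - cProj c hc x)]

theorem cProj_eq_sum (hc : ∀ p, 0 < c p) (x : Vec n) :
    cProj c hc x = ∑ p, x p • cProj c hc (Pi.single p 1) := by
  have h : x = ∑ p, x p • (Pi.single p (1 : ℝ) : Vec n) := by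
    funext q
    simp [Finset.sum_apply, Pi.single_apply]
  conv_lhs => rw [h]
  exact (map_sum (cProjₗ c hc) _ _).trans
    (Finset.sum_congr rfl fun p _ => (cProjₗ c hc).map_smul _ _)

/-! ### The face and its relative interior -/

/-- The barycentre `1 / n` of the face. -/
theorem inv_mem_face (hc : ∀ p, 0 < c p) (hn : n ≠ 0) : (fun _ => (n : ℝ)⁻¹) ∈ face c := by
  rw [mem_face_iff hc]
  have : (n : ℝ) ≠ 0 := Nat.cast_ne_zero.2 hn
  refine ⟨fun p => by positivity, fun i => ?_, fun j => ?_⟩ <;> simp [this]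

/-- Points of the relative interior of the face have positive entries: the segment from the
barycentre can be prolonged slightly beyond them inside the face. -/
theorem pos_of_mem_intrinsicInterior (hc : ∀ p, 0 < c p)
    (hν : ν ∈ intrinsicInterior ℝ (face c)) (p : Fin n × Fin n) : 0 < ν p := by
  have hn : n ≠ 0 := fun h => by subst h; exact p.1.elim0
  have hn' : (0 : ℝ) < (n : ℝ)⁻¹ := by positivity
  have hb := inv_mem_face hc hn
  set b : Vec n := fun _ => (n : ℝ)⁻¹
  have hνF := intrinsicInterior_subset hν
  obtain ⟨y, hy, rfl⟩ := mem_intrinsicInterior.1 hν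
  have hbs : b ∈ affineSpan ℝ (face c) := subset_affineSpan ℝ _ hb
  let g : ℝ → affineSpan ℝ (face c) := fun t =>
    ⟨AffineMap.lineMap (y : Vec n) b t, AffineMap.lineMap_mem t y.2 hbs⟩
  have hg : Continuous g := by
    refine Continuous.subtype_mk ?_ _
    exact AffineMap.lineMap_continuous
  have hg0 : g 0 = y := Subtype.ext (AffineMap.lineMap_apply_zero _ _)
  have hev : ∀ᶠ t in 𝓝 (0 : ℝ), g t ∈ ((↑) ⁻¹' face c : Set (affineSpan ℝ (face c))) := by
    apply hg.continuousAt.eventually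
    rw [hg0]
    exact mem_interior_iff_mem_nhds.1 hy
  obtain ⟨t, ht, ht0⟩ := (((hev.filter_mono nhdsWithin_le_nhds).and
    (self_mem_nhdsWithin : Set.Iio (0 : ℝ) ∈ 𝓝[<] 0)).exists)
  have h1 : 0 ≤ (AffineMap.lineMap (y : Vec n) b t : Vec n) p := ht.1 p
  have h2 : (AffineMap.lineMap (y : Vec n) b t : Vec n) p = (1 - t) * y.1 p + t * (n : ℝ)⁻¹ := by
    simp [AffineMap.lineMap_apply, b]
    ring
  rw [h2] at h1
  have h3 : t < 0 := ht0
  by_contra h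
  have h4 : y.1 p = 0 := le_antisymm (not_lt.1 h) (hνF.1 p)
  rw [h4] at h1
  nlinarith

/-! ### MaxWeight schedules -/

theorem toReal_mem_face (hc : ∀ p, 0 < c p) {s : IVec n} (hs : s ∈ schedules n) :
    s.toReal ∈ face c := by
  simp only [schedules, Finset.mem_filter] at hs
  rw [mem_face_iff hc]
  refine ⟨fun p => Nat.cast_nonneg _, fun i => ?_, fun j => ?_⟩
  · simpa [IVec.toReal] using congrArg (Nat.cast (R := ℝ)) (hs.2.1 i)
  · simpa [IVec.toReal] using congrArg (Nat.cast (R := ℝ)) (hs.2.2 j)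

theorem le_one_of_mem_schedules {s : IVec n} (hs : s ∈ schedules n) (p : Fin n × Fin n) :
    s p ≤ 1 := by
  simp only [schedules, Finset.mem_filter, Fintype.mem_piFinset] at hs
  have := hs.1 p
  simp only [Finset.mem_insert, Finset.mem_singleton] at this
  omega

theorem perm_mem_schedules (τ : Equiv.Perm (Fin n)) :
    (fun p => if τ p.1 = p.2 then 1 else 0 : IVec n) ∈ schedules n := by
  simp only [schedules, Finset.mem_filter, Fintype.mem_piFinset]
  refine ⟨fun p => ?_, fun i => by simp, fun j => ?_⟩
  · by_cases h : τ p.1 = p.2 <;> simp [h]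
  · simp [← Equiv.eq_symm_apply]

theorem mem_schedules_of_mem_maxWeight {q s : IVec n} (hs : s ∈ maxWeight c q) :
    s ∈ schedules n := by
  classical exact (Finset.mem_filter.1 hs).1

/-- By Birkhoff's theorem, a MaxWeight schedule maximizes the weight over the whole face. -/
theorem cInner_le_of_mem_maxWeight (hc : ∀ p, 0 < c p) {q s : IVec n} (hs : s ∈ maxWeight c q)
    {r : Vec n} (hr : r ∈ face c) : cInner c q.toReal r ≤ cInner c q.toReal s.toReal := by
  have hmax : ∀ s' ∈ schedules n, cInner c q.toReal s'.toReal ≤ cInner c q.toReal s.toReal := by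
    classical exact (Finset.mem_filter.1 hs).2
  rw [mem_face_iff hc] at hr
  have hd : Matrix.of (fun i j => r (i, j)) ∈ doublyStochastic ℝ (Fin n) :=
    mem_doublyStochastic_iff_sum.2 ⟨fun i j => hr.1 (i, j), hr.2.1, hr.2.2⟩
  obtain ⟨w, hw0, hw1, hw⟩ := exists_eq_sum_perm_of_mem_doublyStochastic hd
  have hr' : r = ∑ τ, w τ • IVec.toReal (fun p => if τ p.1 = p.2 then 1 else 0) := by
    funext p
    have := congrFun (congrFun hw p.1) p.2
    simp only [Matrix.sum_apply, Matrix.smul_apply, Matrix.of_apply, Equiv.Perm.permMatrix,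
      PEquiv.toMatrix_apply, Equiv.toPEquiv_apply, Option.mem_def, Option.some.injEq] at this
    rw [← this, Finset.sum_apply]
    refine Finset.sum_congr rfl fun τ _ => ?_
    simp [IVec.toReal]
  have h1 : cInner c q.toReal r = ∑ τ, w τ * cInner c q.toReal
      (IVec.toReal (fun p => if τ p.1 = p.2 then 1 else 0)) := by
    rw [hr']
    exact (map_sum (cForm c q.toReal) _ _).trans
      (Finset.sum_congr rfl fun τ _ => (cForm c q.toReal).map_smul _ _)
  rw [h1]
  calc _ ≤ ∑ τ, w τ * cInner c q.toReal s.toReal :=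
        Finset.sum_le_sum fun τ _ =>
          mul_le_mul_of_nonneg_left (hmax _ (perm_mem_schedules τ)) (hw0 τ)
    _ = _ := by rw [← Finset.sum_mul, hw1, one_mul]

theorem exists_le_mul_sqrt (hc : ∀ p, 0 < c p) (hpos : ∀ p, 0 < ν p) :
    ∃ τ > 0, ∀ p, τ ≤ ν p * √(c p) := by
  obtain h | h := isEmpty_or_nonempty (Fin n × Fin n)
  · exact ⟨1, one_pos, fun p => h.elim p⟩
  · obtain ⟨p, hp⟩ := Finite.exists_min fun p => ν p * √(c p)
    exact ⟨_, mul_pos (hpos p) (Real.sqrt_pos.2 (hc p)), hp⟩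

theorem exists_mul_sqrt_cNormSq_le (hc : ∀ p, 0 < c p) (hpos : ∀ p, 0 < ν p) :
    ∃ κ > 0, ∀ x : Vec n, (∀ p, 0 ≤ x p) → κ * √(cNormSq c x) ≤ cInner c x ν := by
  obtain ⟨τ, hτ, hτν⟩ := exists_le_mul_sqrt hc hpos
  refine ⟨τ, hτ, fun x hx => ?_⟩
  have h0 : ∀ p ∈ Finset.univ, 0 ≤ √(c p) * x p := fun p _ =>
    mul_nonneg (Real.sqrt_nonneg _) (hx p)
  have h1 : √(cNormSq c x) ≤ ∑ p, √(c p) * x p := by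
    refine Real.sqrt_le_iff.2 ⟨Finset.sum_nonneg h0, ?_⟩
    have h2 := Finset.sum_sq_le_sq_sum_of_nonneg h0
    rw [cNormSq_eq_sum]
    refine le_trans (le_of_eq (Finset.sum_congr rfl fun p _ => ?_)) h2
    rw [mul_pow, Real.sq_sqrt (hc p).le]
  refine (mul_le_mul_of_nonneg_left h1 hτ.le).trans ?_
  rw [Finset.mul_sum]
  refine Finset.sum_le_sum fun p _ => ?_
  calc τ * (√(c p) * x p) ≤ ν p * √(c p) * (√(c p) * x p) :=
        mul_le_mul_of_nonneg_right (hτν p) (h0 p (Finset.mem_univ p))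
    _ = c p * x p * ν p := by
        linear_combination (ν p * x p) * Real.mul_self_sqrt (hc p).le

/-- The gain of MaxWeight over a fixed point `ν` with positive entries: the weight of a MaxWeight
schedule exceeds that of `ν` by a multiple of the distance from the queue vector to `S_c`, because
`ν` can be moved inside the face in the direction orthogonal to `S_c`. -/
theorem exists_cInner_sub_le (hc : ∀ p, 0 < c p) (hν : ν ∈ face c) (hpos : ∀ p, 0 < ν p) :
    ∃ τ > 0, ∀ q s : IVec n, s ∈ maxWeight c q →
      cInner c q.toReal (ν - s.toReal) ≤
        -τ * √(cNormSq c (q.toReal - cProj c hc q.toReal)) := by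
  obtain ⟨τ, hτ, hτν⟩ := exists_le_mul_sqrt hc hpos
  refine ⟨τ, hτ, fun q s hs => ?_⟩
  set x := q.toReal - cProj c hc q.toReal with hx
  rw [cInner_sub_right]
  obtain h0 | h0 := (Real.sqrt_nonneg (cNormSq c x)).eq_or_lt
  · rw [← h0]
    linarith [cInner_le_of_mem_maxWeight hc hs hν]
  set m := √(cNormSq c x)
  have hm : m ^ 2 = cNormSq c x := Real.sq_sqrt (cNormSq_nonneg hc x)
  have hr : ν + (τ / m) • x ∈ face c := by
    refine ⟨fun p => ?_, fun i => ?_, fun j => ?_⟩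
    · have h1 : (√(c p) * |x p|) ≤ m := by
        apply Real.le_sqrt_of_sq_le
        rw [mul_pow, Real.sq_sqrt (hc p).le, sq_abs]
        exact mul_sq_le_cNormSq hc x p
      have h2 : τ / m * |x p| ≤ ν p := by
        have h3 : τ * |x p| ≤ ν p * m := by
          calc τ * |x p| ≤ ν p * √(c p) * |x p| :=
                mul_le_mul_of_nonneg_right (hτν p) (abs_nonneg _)
            _ = ν p * (√(c p) * |x p|) := by ring
            _ ≤ ν p * m := mul_le_mul_of_nonneg_left h1 (hpos p).le
        rw [div_mul_eq_mul_div, div_le_iff₀ h0]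
        exact h3
      have h4 : -(τ / m * |x p|) ≤ τ / m * x p := by
        rw [← mul_neg]
        exact mul_le_mul_of_nonneg_left (neg_abs_le _) (by positivity)
      simp only [Pi.add_apply, Pi.smul_apply, smul_eq_mul]
      linarith
    · rw [cInner_add_left, cInner_smul_left, hx, cInner_sub_cProj hc _ (rowVec_mem c i), hν.2.1 i]
      simp
    · rw [cInner_add_left, cInner_smul_left, hx, cInner_sub_cProj hc _ (colVec_mem c j), hν.2.2 j]
      simp
  have h := cInner_le_of_mem_maxWeight hc hs hr
  have h5 : cInner c q.toReal x = m ^ 2 := by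
    have h6 := cInner_sub_cProj hc q.toReal (cProj_mem hc q.toReal)
    have h7 : q.toReal = x + cProj c hc q.toReal := by rw [hx]; abel
    conv_lhs => rw [h7]
    rw [cInner_add_left, cInner_comm c (cProj c hc q.toReal), h6, hm, cNormSq, add_zero]
  rw [cInner_add_right, cInner_smul_right, h5] at h
  have h8 : τ / m * m ^ 2 = τ * m := by field_simp
  linarith

/-! ### Distance to the cone of state-space collapse -/

/-- The cone of nonnegative vectors of `S_c`, to which the queue-length vector stays close in heavy
traffic. -/
def coneK (c : Vec n) : Set (Vec n) := {y | y ∈ spaceS c ∧ ∀ p, 0 ≤ y p}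

/-- The squared weighted distance to the cone `coneK c`. -/
noncomputable def coneDist (c x : Vec n) : ℝ := sInf ((fun y => cNormSq c (x - y)) '' coneK c)

theorem coneDist_le (hc : ∀ p, 0 < c p) (x : Vec n) (hy : y ∈ coneK c) :
    coneDist c x ≤ cNormSq c (x - y) :=
  csInf_le ⟨0, by rintro _ ⟨z, _, rfl⟩; exact cNormSq_nonneg hc _⟩ ⟨y, hy, rfl⟩

theorem zero_mem_coneK (c : Vec n) : 0 ∈ coneK c := ⟨(spaceS c).zero_mem, fun _ => le_rfl⟩

theorem exists_cNormSq_lt (x : Vec n) : ∃ y ∈ coneK c, cNormSq c (x - y) < coneDist c x + 1 := by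
  obtain ⟨_, ⟨y, hy, rfl⟩, h⟩ := exists_lt_of_csInf_lt
    (s := (fun y => cNormSq c (x - y)) '' coneK c) ⟨_, 0, zero_mem_coneK c, rfl⟩
    (lt_add_one (coneDist c x))
  exact ⟨y, hy, h⟩

theorem cNormSq_sub_cProj_le_coneDist (hc : ∀ p, 0 < c p) (x : Vec n) :
    cNormSq c (x - cProj c hc x) ≤ coneDist c x := by
  refine le_csInf ⟨_, 0, zero_mem_coneK c, rfl⟩ ?_
  rintro _ ⟨y, hy, rfl⟩
  show _ ≤ cNormSq c (x - y)
  linarith [cNormSq_sub_of_mem hc x hy.1, cNormSq_nonneg hc (cProj c hc x - y)]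

theorem coneDist_nonneg (hc : ∀ p, 0 < c p) (x : Vec n) : 0 ≤ coneDist c x :=
  (cNormSq_nonneg hc _).trans (cNormSq_sub_cProj_le_coneDist hc x)

/-- For nonnegative vectors the distance to the cone is comparable to the distance to its span:
adding a multiple of `1 / c` to the projection onto `S_c` makes it nonnegative. -/
theorem exists_coneDist_le (hc : ∀ p, 0 < c p) :
    ∃ L > 0, ∀ x : Vec n, (∀ p, 0 ≤ x p) →
      coneDist c x ≤ L * cNormSq c (x - cProj c hc x) := by
  set e : Vec n := fun p => 1 / c p
  have he0 := cNormSq_nonneg hc e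
  have hC : 0 ≤ ∑ p, c p := Finset.sum_nonneg fun p _ => (hc p).le
  refine ⟨2 + 2 * (∑ p, c p) * cNormSq c e, by positivity, fun x hx => ?_⟩
  set z := x - cProj c hc x with hz
  set h := ∑ p, c p * |z p|
  have hh : h ^ 2 ≤ (∑ p, c p) * cNormSq c z := by
    have h1 := Finset.sum_mul_sq_le_sq_mul_sq Finset.univ
      (fun p => √(c p)) (fun p => √(c p) * |z p|)
    have h2 : ∀ p, √(c p) ^ 2 = c p := fun p => Real.sq_sqrt (hc p).le
    have h3 : ∑ p, √(c p) * (√(c p) * |z p|) = h :=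
      Finset.sum_congr rfl fun p _ => by linear_combination |z p| * h2 p
    have h4 : ∑ p, (√(c p) * |z p|) ^ 2 = cNormSq c z := by
      rw [cNormSq_eq_sum]
      exact Finset.sum_congr rfl fun p _ => by rw [mul_pow, h2, sq_abs]
    rwa [h3, h4, Finset.sum_congr rfl fun p _ => h2 p] at h1
  have hy : cProj c hc x + h • e ∈ coneK c := by
    refine ⟨(spaceS c).add_mem (cProj_mem hc x) ((spaceS c).smul_mem _ (one_div_mem c)),
      fun p => ?_⟩
    have h1 : c p * |z p| ≤ h := Finset.single_le_sum (f := fun p => c p * |z p|)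
      (fun p _ => mul_nonneg (hc p).le (abs_nonneg _)) (Finset.mem_univ p)
    have h2 : |z p| ≤ h * (1 / c p) := by
      rw [mul_one_div, le_div_iff₀ (hc p)]
      linarith
    have h3 : cProj c hc x p = x p - z p := by simp [hz]
    simp only [Pi.add_apply, Pi.smul_apply, smul_eq_mul, h3, e]
    linarith [hx p, le_abs_self (z p)]
  refine (coneDist_le hc x hy).trans ?_
  have h4 : x - (cProj c hc x + h • e) = z + (-h) • e := by rw [hz, neg_smul]; abel
  rw [h4]
  refine (cNormSq_add_le hc _ _).trans ?_
  rw [cNormSq_smul, neg_sq]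
  nlinarith [mul_le_mul_of_nonneg_right hh he0]

/-! ### One step of the dynamics -/

theorem toReal_next (q a s : IVec n) :
    (next q a s).toReal = q.toReal + (a.toReal - s.toReal) + (unused q a s).toReal := by
  funext p
  have h : ((next q a s p : ℕ) : ℝ) + s p = q p + a p + unused q a s p := by
    exact_mod_cast next_add q a s p
  simp only [IVec.toReal, Pi.add_apply, Pi.sub_apply]
  linarith

theorem cInner_next_unused (c : Vec n) (q a s : IVec n) :
    cInner c (next q a s).toReal (unused q a s).toReal = 0 := by
  refine Finset.sum_eq_zero fun p _ => ?_
  have h : ((next q a s p : ℕ) : ℝ) * unused q a s p = 0 := by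
    exact_mod_cast next_mul_unused q a s p
  simp only [IVec.toReal]
  rw [mul_assoc, h, mul_zero]

/-- The unused service only brings the queue vector closer to a nonnegative vector. -/
theorem cNormSq_next_sub_le (hc : ∀ p, 0 < c p) (hy : ∀ p, 0 ≤ y p) (q a s : IVec n) :
    cNormSq c ((next q a s).toReal - y) ≤ cNormSq c (q.toReal - y) +
      (2 * cInner c (q.toReal - y) (a.toReal - s.toReal) + cNormSq c (a.toReal - s.toReal)) := by
  have h1 := cInner_next_unused c q a s
  have h2 : 0 ≤ cInner c y (unused q a s).toReal := Finset.sum_nonneg fun p _ =>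
    mul_nonneg (mul_nonneg (hc p).le (hy p)) (Nat.cast_nonneg _)
  have h3 := cNormSq_nonneg hc (unused q a s).toReal
  rw [← add_assoc, ← cNormSq_add]
  have h4 : q.toReal - y + (a.toReal - s.toReal) =
      ((next q a s).toReal - y) - (unused q a s).toReal := by
    rw [toReal_next]; abel
  rw [h4, cNormSq_sub _ _ (unused q a s).toReal, cInner_sub_left, h1]
  linarith

/-! ### A uniform moment bound from a negative drift -/

/-- The bound on the mean of a Lyapunov function in `integral_le_of_drift`. -/
noncomputable def driftBound (δ C K : ℝ) : ℝ :=
  (2 * K + 2 * C ^ 2 + 1) ^ 3 / (4 * δ ^ 2) + 2 * C ^ 2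

/-- The scalar inequality behind `integral_le_of_drift`, with `y = √x` `-2 δ y ^ 3` the leading
drift term of the squared Lyapunov function. -/
theorem drift_poly_le {δ C K y : ℝ} (hδ : 0 < δ) (hK : 0 ≤ K) (hy : 0 ≤ y) :
    2 * y ^ 2 * (-δ * y + K) + C ^ 2 * (y + 1) ^ 2 ≤
      -y ^ 2 + driftBound δ C K := by
  rw [driftBound]
  set L := 2 * K + 2 * C ^ 2 + 1 with hL
  have hL0 : 0 < L := by positivity
  have h1 : C ^ 2 * (y + 1) ^ 2 ≤ C ^ 2 * (2 * y ^ 2 + 2) :=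
    mul_le_mul_of_nonneg_left (by nlinarith [sq_nonneg (y - 1)]) (sq_nonneg C)
  have h2 : -2 * δ * y ^ 3 + L * y ^ 2 ≤ L ^ 3 / (4 * δ ^ 2) := by
    obtain h | h := le_total L (2 * δ * y)
    · have h3 : L * y ^ 2 ≤ 2 * δ * y * y ^ 2 := mul_le_mul_of_nonneg_right h (sq_nonneg y)
      have h4 : 0 ≤ L ^ 3 / (4 * δ ^ 2) := by positivity
      nlinarith
    · have h3 : L ^ 3 / (4 * δ ^ 2) = L * (L / (2 * δ)) ^ 2 := by
        field_simp
        ring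
      have h4 : y ≤ L / (2 * δ) := by
        rw [le_div_iff₀ (by positivity)]
        linarith
      have h5 : y ^ 2 ≤ (L / (2 * δ)) ^ 2 := pow_le_pow_left₀ hy h4 2
      have h6 : 0 ≤ 2 * δ * y ^ 3 := by positivity
      rw [h3]
      nlinarith
  nlinarith

theorem integrable_min_sq {Ω : Type*} [MeasurableSpace Ω] {μ : Measure Ω} [IsFiniteMeasure μ]
    {f : Ω → ℝ} (hf : Measurable f) (m : ℝ) :
    Integrable (fun ω => min (f ω ^ 2) (m ^ 2)) μ := by
  refine Integrable.of_bound (C := m ^ 2) (by fun_prop) (Eventually.of_forall fun a => ?_)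
  rw [Real.norm_of_nonneg (le_min (sq_nonneg _) (sq_nonneg _))]
  exact min_le_right _ _

section Drift

variable {S T : Type*} [MeasurableSpace S] [MeasurableSpace T] {M : Measure S} {P : Measure T}
  [IsProbabilityMeasure M] [IsProbabilityMeasure P]

/-- The drift of the truncated square of a Lyapunov function, from one state with value `x`. -/
theorem integral_min_sq_le {x δ C K : ℝ} {X' D : T → ℝ} {m : ℝ} (hm : 0 ≤ m)
    (hX'm : Measurable X') (hDm : Measurable D) (hx : 0 ≤ x) (hX' : ∀ a, 0 ≤ X' a)
    (hδ : 0 < δ) (hK : 0 ≤ K)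
    (hle : ∀ᵐ a ∂P, X' a ≤ x + D a) (hD : ∀ᵐ a ∂P, |D a| ≤ C * (√x + 1))
    (hdrift : ∫ a, D a ∂P ≤ -δ * √x + K) :
    ∫ a, min (X' a ^ 2) (m ^ 2) ∂P ≤ min (x ^ 2) (m ^ 2) -
      (Set.Iio m).indicator
        (fun x => x - driftBound δ C K) x := by
  have hint : Integrable (fun a => min (X' a ^ 2) (m ^ 2)) P := integrable_min_sq hX'm m
  by_cases hxm : x < m
  · rw [Set.indicator_of_mem (Set.mem_Iio.2 hxm), min_eq_left (pow_le_pow_left₀ hx hxm.le 2)]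
    have hDi : Integrable D P := Integrable.of_bound hDm.aestronglyMeasurable _ hD
    have hD2 : ∀ᵐ a ∂P, D a ^ 2 ≤ (C * (√x + 1)) ^ 2 := by
      filter_upwards [hD] with a ha
      exact sq_le_sq' (neg_le_of_abs_le ha) (le_of_abs_le ha)
    have hD2i : Integrable (fun a => D a ^ 2) P := by
      refine Integrable.of_bound (C := (C * (√x + 1)) ^ 2) (by fun_prop) ?_
      filter_upwards [hD2] with a ha
      rwa [Real.norm_of_nonneg (sq_nonneg _)]
    have h1 : ∫ a, min (X' a ^ 2) (m ^ 2) ∂P ≤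
        ∫ a, (x ^ 2 + 2 * x * D a) + D a ^ 2 ∂P := by
      refine integral_mono_ae hint (((integrable_const _).add (hDi.const_mul _)).add hD2i) ?_
      filter_upwards [hle] with a ha
      refine (min_le_left _ _).trans ((pow_le_pow_left₀ (hX' a) ha 2).trans (le_of_eq ?_))
      ring
    have hxi : Integrable (fun a => x ^ 2 + 2 * x * D a) P :=
      (integrable_const _).add (hDi.const_mul _)
    have h2 : ∫ a, (x ^ 2 + 2 * x * D a) + D a ^ 2 ∂P =
        x ^ 2 + 2 * x * ∫ a, D a ∂P + ∫ a, D a ^ 2 ∂P := by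
      rw [integral_add hxi hD2i,
        integral_add (integrable_const _) (hDi.const_mul _), integral_const_mul]
      simp
    have h3 : ∫ a, D a ^ 2 ∂P ≤ (C * (√x + 1)) ^ 2 := by
      have := integral_mono_ae hD2i (integrable_const _) hD2
      simpa using this
    have h4 := drift_poly_le (C := C) hδ hK (Real.sqrt_nonneg x)
    rw [Real.sq_sqrt hx] at h4
    have h5 : 2 * x * ∫ a, D a ∂P ≤ 2 * x * (-δ * √x + K) :=
      mul_le_mul_of_nonneg_left hdrift (by positivity)
    rw [mul_pow] at h3
    linarith
  · rw [Set.indicator_of_notMem (by simpa using hxm), sub_zero,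
      min_eq_right (pow_le_pow_left₀ hm (not_lt.1 hxm) 2)]
    have := integral_mono hint (integrable_const (m ^ 2)) fun a => min_le_right _ _
    simpa using this

/-- A moment bound for a stationary chain. Let `X` be a Lyapunov function of the state and `X'` its
value one step later, with the same law. If the increments are at most `D`, of size `O(√X)`, with
mean at most `-δ √X + K`, then the mean of `X` is bounded in terms of the constants alone. The
square of `X` has drift at most `-X + const`; truncating it makes stationarity applicable without
an a priori moment bound. -/
theorem integral_le_of_drift {X : S → ℝ} {X' : S × T → ℝ} {D : S → T → ℝ} {δ C K : ℝ}
    (hX : Measurable X) (hX'm : Measurable X') (hDm : ∀ x, Measurable (D x))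
    (hX0 : ∀ x, 0 ≤ X x) (hX'0 : ∀ z, 0 ≤ X' z) (hid : IdentDistrib X' X (M.prod P) M)
    (hδ : 0 < δ) (hK : 0 ≤ K)
    (hle : ∀ᵐ x ∂M, ∀ᵐ a ∂P, X' (x, a) ≤ X x + D x a)
    (hD : ∀ᵐ x ∂M, ∀ᵐ a ∂P, |D x a| ≤ C * (√(X x) + 1))
    (hdrift : ∀ᵐ x ∂M, ∫ a, D x a ∂P ≤ -δ * √(X x) + K) :
    Integrable X M ∧ ∫ x, X x ∂M ≤ driftBound δ C K := by
  set B := driftBound δ C K with hB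
  have hB0 : 0 ≤ B := by
    rw [hB, driftBound]
    positivity
  -- the truncated first moments are bounded by `B`
  have key : ∀ m : ℕ, ∫⁻ x, ENNReal.ofReal ((Set.Iio (m : ℝ)).indicator id (X x)) ∂M ≤
      ENNReal.ofReal B := by
    intro m
    have hgi : Integrable (fun x => (Set.Iio (m : ℝ)).indicator (fun x => x - B) (X x)) M := by
      refine Integrable.of_bound (C := m + B)
        (((measurable_id.sub_const B).indicator measurableSet_Iio).comp hX).aestronglyMeasurable
        (Eventually.of_forall fun x => ?_)
      by_cases h : X x < m
      · rw [Set.indicator_of_mem (Set.mem_Iio.2 h), Real.norm_eq_abs, abs_le]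
        constructor <;> linarith [hX0 x]
      · rw [Set.indicator_of_notMem (by simpa using h)]
        simp only [norm_zero]
        positivity
    have hii : Integrable (fun x => (Set.Iio (m : ℝ)).indicator id (X x)) M := by
      refine Integrable.of_bound (C := m)
        ((measurable_id.indicator measurableSet_Iio).comp hX).aestronglyMeasurable
        (Eventually.of_forall fun x => ?_)
      by_cases h : X x < m
      · rw [Set.indicator_of_mem (Set.mem_Iio.2 h), id, Real.norm_of_nonneg (hX0 x)]
        exact h.le
      · rw [Set.indicator_of_notMem (by simpa using h)]
        simp
    have h1 : ∫ z, min (X' z ^ 2) ((m : ℝ) ^ 2) ∂(M.prod P) =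
        ∫ x, min (X x ^ 2) ((m : ℝ) ^ 2) ∂M :=
      (hid.comp (u := fun t : ℝ => min (t ^ 2) ((m : ℝ) ^ 2)) (by fun_prop)).integral_eq
    rw [integral_prod _ (integrable_min_sq hX'm m)] at h1
    have h2 : ∫ x, ∫ a, min (X' (x, a) ^ 2) ((m : ℝ) ^ 2) ∂P ∂M ≤
        ∫ x, (min (X x ^ 2) ((m : ℝ) ^ 2) -
          (Set.Iio (m : ℝ)).indicator (fun x => x - B) (X x)) ∂M := by
      refine integral_mono_ae (integrable_min_sq hX'm m).integral_prod_left
        ((integrable_min_sq hX m).sub hgi) ?_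
      filter_upwards [hle, hD, hdrift] with x h1 h2 h3
      exact integral_min_sq_le m.cast_nonneg (hX'm.comp measurable_prodMk_left) (hDm x) (hX0 x)
        (fun a => hX'0 _) hδ hK h1 h2 h3
    rw [h1, integral_sub (integrable_min_sq hX m) hgi] at h2
    have h3 : ∫ x, (Set.Iio (m : ℝ)).indicator id (X x) ∂M ≤
        ∫ x, ((Set.Iio (m : ℝ)).indicator (fun x => x - B) (X x) + B) ∂M := by
      refine integral_mono hii (hgi.add (integrable_const B)) fun x => ?_
      by_cases h : X x < m
      · rw [Set.indicator_of_mem (Set.mem_Iio.2 h)]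
        simp only [Set.indicator_of_mem (Set.mem_Iio.2 h)]
        simp
      · rw [Set.indicator_of_notMem (by simpa using h)]
        simp only [Set.indicator_of_notMem (show X x ∉ Set.Iio (m : ℝ) by simpa using h)]
        linarith
    rw [integral_add hgi (integrable_const B)] at h3
    simp only [integral_const, probReal_univ, one_smul] at h3
    rw [← ofReal_integral_eq_lintegral_ofReal hii (Eventually.of_forall fun x =>
      Set.indicator_apply_nonneg fun _ => hX0 x)]
    exact ENNReal.ofReal_le_ofReal (by linarith)
  have hlim : ∫⁻ x, ENNReal.ofReal (X x) ∂M ≤ ENNReal.ofReal B := by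
    have h1 : ∀ x, ENNReal.ofReal (X x) =
        liminf (fun m : ℕ => ENNReal.ofReal ((Set.Iio (m : ℝ)).indicator id (X x))) atTop := by
      intro x
      refine (Tendsto.liminf_eq ?_).symm
      refine tendsto_const_nhds.congr' ?_
      filter_upwards [eventually_gt_atTop ⌈X x⌉₊] with m hm
      have : X x < m := (Nat.le_ceil _).trans_lt (by exact_mod_cast hm)
      rw [Set.indicator_of_mem (Set.mem_Iio.2 this), id]
    simp_rw [h1]
    refine (lintegral_liminf_le fun m => ?_).trans ?_
    · exact ((measurable_id.indicator measurableSet_Iio).comp hX).ennreal_ofReal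
    · exact liminf_le_of_le (by isBoundedDefault) fun b hb => by
        obtain ⟨m, hm⟩ := hb.exists
        exact hm.trans (key m)
  have hint : Integrable X M := by
    refine ⟨hX.aestronglyMeasurable, ?_⟩
    rw [hasFiniteIntegral_iff_ofReal (Eventually.of_forall hX0)]
    exact hlim.trans_lt ENNReal.ofReal_lt_top
  refine ⟨hint, ?_⟩
  rw [← ofReal_integral_eq_lintegral_ofReal hint (Eventually.of_forall hX0)] at hlim
  exact (ENNReal.ofReal_le_ofReal_iff hB0).1 hlim

end Drift

/-! ### Stationarity and the joint law of one slot -/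

theorem pmf_eq_of_le {α : Type*} {p r : PMF α} (h : ∀ x, p x ≤ r x) : p = r := by
  ext x
  refine le_antisymm (h x) (not_lt.1 fun hx => ?_)
  have := ENNReal.tsum_lt_tsum (by simp [p.tsum_coe]) h hx
  simp [p.tsum_coe, r.tsum_coe] at this

variable {α : Fin n × Fin n → PMF ℕ} {π : PMF (IVec n)} {Amax : ℕ}

/-- A limit in distribution of the queue-length chain is stationary. Fatou's lemma gives one
inequality between point masses, and both sides have total mass one. -/
theorem IsSteadyState.bind_step (h : IsSteadyState c α π) : π.bind (step c α) = π := by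
  obtain ⟨μ, hμ⟩ := h
  refine pmf_eq_of_le fun q' => ?_
  rw [PMF.bind_apply]
  refine ENNReal.summable.tsum_le_of_sum_le fun F => ?_
  have h1 : Tendsto (fun t => ∑ q ∈ F, lawAt c α μ t q * step c α q q') atTop
      (𝓝 (∑ q ∈ F, π q * step c α q q')) :=
    tendsto_finsetSum _ fun q _ => ENNReal.Tendsto.mul_const (hμ q) (Or.inr (PMF.apply_ne_top _ _))
  refine le_of_tendsto_of_tendsto' h1 ((tendsto_add_atTop_iff_nat 1).2 (hμ q')) fun t => ?_
  exact ENNReal.sum_le_tsum F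

/-- The joint law of the queue lengths and the schedule in one slot. -/
noncomputable def stateLaw (c : Vec n) (π : PMF (IVec n)) : PMF (IVec n × IVec n) :=
  π.bind fun q => (PMF.uniformOfFinset (maxWeight c q) (maxWeight_nonempty c q)).map (Prod.mk q)

/-- The law of the arrival vector of one slot as a product measure. -/
noncomputable abbrev arrivalLaw (α : Fin n × Fin n → PMF ℕ) : Measure (IVec n) :=
  Measure.pi fun p => (α p).toMeasure

/-- The joint law of queue lengths, schedule and arrivals in one slot: arrivals are independent
of the state and the schedule. -/
noncomputable abbrev slotLaw (c : Vec n) (α : Fin n × Fin n → PMF ℕ) (π : PMF (IVec n)) :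
    Measure ((IVec n × IVec n) × IVec n) :=
  (stateLaw c π).toMeasure.prod (arrivalLaw α)

theorem map_fst_stateLaw (c : Vec n) (π : PMF (IVec n)) :
    (stateLaw c π).toMeasure.map Prod.fst = π.toMeasure := by
  rw [PMF.toMeasure_map (hf := measurable_fst), stateLaw, PMF.map_bind]
  congr 1
  conv_rhs => rw [← PMF.bind_pure π]
  congr 1
  funext q
  rw [PMF.map_comp]
  exact PMF.map_const _ _

theorem ae_stateLaw (c : Vec n) (π : PMF (IVec n)) :
    ∀ᵐ x ∂(stateLaw c π).toMeasure, x.2 ∈ maxWeight c x.1 := by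
  rw [ae_iff, PMF.toMeasure_apply_eq_zero_iff _ (Set.to_countable _).measurableSet,
    Set.disjoint_left]
  intro x hx hx'
  apply hx'
  rw [stateLaw, PMF.mem_support_bind_iff] at hx
  obtain ⟨q, _, hq⟩ := hx
  rw [PMF.mem_support_map_iff] at hq
  obtain ⟨s, hs, rfl⟩ := hq
  exact (PMF.mem_support_uniformOfFinset_iff _ _).1 hs

theorem slotLaw_eq (c : Vec n) (α : Fin n × Fin n → PMF ℕ) (π : PMF (IVec n)) :
    slotLaw c α π =
      ((stateLaw c π).bind fun x => (arrivals α).map (Prod.mk x)).toMeasure := by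
  refine Measure.ext_of_singleton fun z => ?_
  obtain ⟨x, a⟩ := z
  rw [PMF.toMeasure_apply_singleton _ _ (measurableSet_singleton _), PMF.bind_apply,
    tsum_eq_single x, PMF.map_apply, tsum_eq_single a]
  · rw [← Set.singleton_prod_singleton, Measure.prod_prod,
      PMF.toMeasure_apply_singleton _ _ (measurableSet_singleton _)]
    simp [arrivals, Measure.toPMF_apply]
  · intro b hb
    simp [hb.symm]
  · intro y hy
    rw [PMF.map_apply]
    simp [hy.symm]

/-- In steady state the queue lengths after one slot have the law of the queue lengths. -/
theorem map_next_slotLaw (h : IsSteadyState c α π) :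
    (slotLaw c α π).map (fun z => next z.1.1 z.2 z.1.2) = π.toMeasure := by
  rw [slotLaw_eq, PMF.toMeasure_map (hf := measurable_of_countable _)]
  congr 1
  conv_rhs => rw [← h.bind_step]
  rw [PMF.map_bind, stateLaw, PMF.bind_bind]
  congr 1
  funext q
  rw [PMF.bind_map, step]
  congr 1
  funext s
  simp only [Function.comp, PMF.map_comp]
  rfl

/-! ### Moments of the arrivals -/

theorem ae_le_arrivalLaw (hb : ∀ p, ∀ k ∈ (α p).support, k ≤ Amax) :
    ∀ᵐ a ∂arrivalLaw α, ∀ p, a p ≤ Amax := by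
  refine ae_all_iff.2 fun p => ?_
  have h : ∀ᵐ k ∂(α p).toMeasure, k ≤ Amax := by
    rw [ae_iff, PMF.toMeasure_apply_eq_zero_iff _ (Set.to_countable _).measurableSet,
      Set.disjoint_left]
    exact fun k hk hk' => hk' (hb p k hk)
  exact (measurePreserving_eval (fun p => (α p).toMeasure) p).quasiMeasurePreserving.ae h

theorem integral_eval (f : ℕ → ℝ) (p : Fin n × Fin n) :
    ∫ a, f (a p) ∂arrivalLaw α = ∫ k, f k ∂(α p).toMeasure := by
  rw [← (measurePreserving_eval (fun p => (α p).toMeasure) p).map_eq,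
    integral_map (measurable_pi_apply p).aemeasurable
      (measurable_of_countable f).aestronglyMeasurable]

/-- Functions of bounded arrivals are integrable. -/
theorem integrable_arrivalLaw (hb : ∀ p, ∀ k ∈ (α p).support, k ≤ Amax) (f : IVec n → ℝ) :
    Integrable f (arrivalLaw α) := by
  have hfin : (Set.Iic (fun _ => Amax : IVec n)).Finite := Set.finite_Iic _
  obtain ⟨C, hC⟩ := (hfin.image fun a => ‖f a‖).bddAbove
  refine Integrable.of_bound (C := C) (measurable_of_countable f).aestronglyMeasurable ?_
  filter_upwards [ae_le_arrivalLaw hb] with a ha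
  exact hC ⟨a, ha, rfl⟩

theorem integral_centered (hb : ∀ p, ∀ k ∈ (α p).support, k ≤ Amax) (p : Fin n × Fin n) :
    ∫ a, ((a p : ℝ) - mean (α p)) ∂arrivalLaw α = 0 := by
  rw [integral_sub (integrable_arrivalLaw hb fun a => (a p : ℝ)) (integrable_const _),
    integral_eval (fun k => (k : ℝ)) p]
  simp [mean]

theorem integral_cInner_sub (hb : ∀ p, ∀ k ∈ (α p).support, k ≤ Amax) (x y : Vec n) :
    ∫ a, cInner c x (IVec.toReal a - y) ∂arrivalLaw α =
      cInner c x ((fun p => mean (α p)) - y) := by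
  simp only [cInner, Pi.sub_apply, IVec.toReal]
  rw [integral_finsetSum _ fun p _ => integrable_arrivalLaw hb _]
  refine Finset.sum_congr rfl fun p _ => ?_
  rw [integral_const_mul, integral_sub (integrable_arrivalLaw hb fun a => (a p : ℝ))
    (integrable_const _), integral_eval (fun k => (k : ℝ)) p]
  simp [mean]

/-- The covariance matrix of the arrivals is diagonal. -/
theorem integral_mul_centered (hb : ∀ p, ∀ k ∈ (α p).support, k ≤ Amax) (p r : Fin n × Fin n) :
    ∫ a, ((a p : ℝ) - mean (α p)) * ((a r : ℝ) - mean (α r)) ∂arrivalLaw α =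
      if p = r then var (α p) else 0 := by
  split_ifs with h
  · subst h
    rw [integral_eval (fun k => ((k : ℝ) - mean (α p)) * ((k : ℝ) - mean (α p))) p, var,
      variance_eq_integral (measurable_of_countable _).aemeasurable]
    exact integral_congr_ae (Eventually.of_forall fun k => (sq _).symm)
  · have hind : iIndepFun (fun p (a : IVec n) => (a p : ℝ) - mean (α p)) (arrivalLaw α) :=
      iIndepFun_pi (X := fun p (k : ℕ) => (k : ℝ) - mean (α p))
        fun p => (measurable_of_countable _).aemeasurable
    have h2 := (hind.indepFun h).integral_fun_mul_eq_mul_integral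
      (measurable_of_countable _).aestronglyMeasurable
      (measurable_of_countable _).aestronglyMeasurable
    rw [h2, integral_centered hb, zero_mul]

/-- The mean squared length of the projection of the centred arrivals. -/
theorem integral_cNormSq_cProj (hc : ∀ p, 0 < c p) (hb : ∀ p, ∀ k ∈ (α p).support, k ≤ Amax) :
    ∫ a, cNormSq c (cProj c hc (IVec.toReal a - fun p => mean (α p))) ∂arrivalLaw α =
      ∑ p, var (α p) * zeta c hc p := by
  have h : ∀ x : Vec n, cNormSq c (cProj c hc x) = ∑ p, ∑ r, x p * x r *
      cInner c (cProj c hc (Pi.single p 1)) (cProj c hc (Pi.single r 1)) := by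
    intro x
    rw [cProj_eq_sum hc x, cNormSq]
    have h1 : ∀ u : Vec n, cInner c u (∑ p, x p • cProj c hc (Pi.single p 1)) =
        ∑ p, x p * cInner c u (cProj c hc (Pi.single p 1)) := fun u =>
      (map_sum (cForm c u) _ _).trans
        (Finset.sum_congr rfl fun p _ => (cForm c u).map_smul _ _)
    rw [h1]
    refine Finset.sum_congr rfl fun p _ => ?_
    rw [cInner_comm, h1, Finset.mul_sum]
    exact Finset.sum_congr rfl fun r _ => by ring
  simp only [h]
  rw [integral_finsetSum _ fun p _ => integrable_arrivalLaw hb _]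
  refine Finset.sum_congr rfl fun p _ => ?_
  rw [integral_finsetSum _ fun r _ => integrable_arrivalLaw hb _]
  simp only [Pi.sub_apply, IVec.toReal, integral_mul_const, integral_mul_centered hb]
  simp [zeta, cNormSq]

/-! ### Integrals over one slot in steady state -/

theorem measurePreserving_queue (c : Vec n) (α : Fin n × Fin n → PMF ℕ) (π : PMF (IVec n)) :
    MeasurePreserving (fun z : (IVec n × IVec n) × IVec n => z.1.1) (slotLaw c α π)
      π.toMeasure :=
  (MeasurePreserving.mk measurable_fst (map_fst_stateLaw c π)).comp measurePreserving_fst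

theorem measurePreserving_next (h : IsSteadyState c α π) :
    MeasurePreserving (fun z : (IVec n × IVec n) × IVec n => next z.1.1 z.2 z.1.2)
      (slotLaw c α π) π.toMeasure :=
  ⟨measurable_of_countable _, map_next_slotLaw h⟩

theorem integral_queue (f : IVec n → ℝ) :
    ∫ z, f z.1.1 ∂slotLaw c α π = ∫ q, f q ∂π.toMeasure := by
  rw [← (measurePreserving_queue c α π).map_eq,
    integral_map (measurePreserving_queue c α π).measurable.aemeasurable
      (measurable_of_countable f).aestronglyMeasurable]

theorem integral_next (h : IsSteadyState c α π) (f : IVec n → ℝ) :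
    ∫ z, f (next z.1.1 z.2 z.1.2) ∂slotLaw c α π = ∫ q, f q ∂π.toMeasure := by
  rw [← (measurePreserving_next h).map_eq,
    integral_map (measurePreserving_next h).measurable.aemeasurable
      (measurable_of_countable f).aestronglyMeasurable]

theorem integrable_queue {f : IVec n → ℝ} (hf : Integrable f π.toMeasure) :
    Integrable (fun z => f z.1.1) (slotLaw c α π) :=
  (measurePreserving_queue c α π).integrable_comp_of_integrable hf

theorem integrable_next (h : IsSteadyState c α π) {f : IVec n → ℝ}
    (hf : Integrable f π.toMeasure) :
    Integrable (fun z => f (next z.1.1 z.2 z.1.2)) (slotLaw c α π) :=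
  (measurePreserving_next h).integrable_comp_of_integrable hf

theorem ae_slotLaw (hb : ∀ p, ∀ k ∈ (α p).support, k ≤ Amax) :
    ∀ᵐ z ∂slotLaw c α π, z.1.2 ∈ maxWeight c z.1.1 ∧ ∀ p, z.2 p ≤ Amax := by
  have h1 : ∀ᵐ z ∂slotLaw c α π, z.1.2 ∈ maxWeight c z.1.1 :=
    measurePreserving_fst.quasiMeasurePreserving.ae (ae_stateLaw c π)
  have h2 : ∀ᵐ z ∂slotLaw c α π, ∀ p, z.2 p ≤ Amax :=
    measurePreserving_snd.quasiMeasurePreserving.ae (ae_le_arrivalLaw hb)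
  exact h1.and h2

/-! ### State-space collapse -/

/-- A bound on the squared weighted norm of arrivals minus services. -/
noncomputable def jumpSq (c : Vec n) (Amax : ℕ) : ℝ := ((Amax : ℝ) + 1) ^ 2 * ∑ p, c p

theorem jumpSq_nonneg (hc : ∀ p, 0 < c p) (Amax : ℕ) : 0 ≤ jumpSq c Amax :=
  mul_nonneg (sq_nonneg _) (Finset.sum_nonneg fun p _ => (hc p).le)

theorem cNormSq_arrivals_sub_le (hc : ∀ p, 0 < c p) {a s : IVec n} (ha : ∀ p, a p ≤ Amax)
    (hs : s ∈ schedules n) : cNormSq c (a.toReal - s.toReal) ≤ jumpSq c Amax := by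
  refine cNormSq_le_of_abs_le hc fun p => ?_
  have h1 : (a p : ℝ) ≤ Amax := by exact_mod_cast ha p
  have h2 : (s p : ℝ) ≤ 1 := by exact_mod_cast le_one_of_mem_schedules hs p
  have h3 : (0 : ℝ) ≤ a p := Nat.cast_nonneg _
  have h4 : (0 : ℝ) ≤ s p := Nat.cast_nonneg _
  simp only [IVec.toReal, Pi.sub_apply]
  rw [abs_le]
  constructor <;> linarith

theorem sqrt_add_one_le {v : ℝ} (hv : 0 ≤ v) : √(v + 1) ≤ √v + 1 := by
  refine Real.sqrt_le_iff.2 ⟨by positivity, ?_⟩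
  nlinarith [Real.sq_sqrt hv, Real.sqrt_nonneg v]

/-- The steady-state mean of a Lyapunov function `V` that is a squared distance up to an additive
constant: `Y q` is an approximately nearest nonnegative point to `q`, towards which the mean motion
of the queue vector is at least `δ √V` up to a constant. -/
theorem integral_le_of_comparison (hc : ∀ p, 0 < c p) (h : IsSteadyState c α π)
    (hb : ∀ p, ∀ k ∈ (α p).support, k ≤ Amax) {V : Vec n → ℝ} (hV : ∀ x, 0 ≤ V x)
    {Y : IVec n → Vec n} (hY : ∀ q p, 0 ≤ Y q p) (hVY : ∀ q x, V x ≤ cNormSq c (x - Y q))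
    (hYV : ∀ q : IVec n, cNormSq c (q.toReal - Y q) ≤ V q.toReal + 1) {δ K : ℝ} (hδ : 0 < δ)
    (hK : 0 ≤ K)
    (hdrift : ∀ q s, s ∈ maxWeight c q →
      cInner c (q.toReal - Y q) ((fun p => mean (α p)) - s.toReal) ≤ -δ * √(V q.toReal) + K) :
    Integrable (fun q : IVec n => V q.toReal) π.toMeasure ∧
      ∫ q : IVec n, V q.toReal ∂π.toMeasure ≤
        driftBound (2 * δ) (1 + jumpSq c Amax + 2 * √(jumpSq c Amax))
          (1 + jumpSq c Amax + 2 * K) := by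
  set J := jumpSq c Amax with hJ
  have hJ0 : 0 ≤ J := jumpSq_nonneg hc Amax
  have hfst : MeasurePreserving (Prod.fst : IVec n × IVec n → IVec n) (stateLaw c π).toMeasure
      π.toMeasure := ⟨measurable_fst, map_fst_stateLaw c π⟩
  have hm : Measurable fun q : IVec n => V q.toReal := measurable_of_countable _
  have key := integral_le_of_drift (M := (stateLaw c π).toMeasure) (P := arrivalLaw α)
    (X := fun x => V x.1.toReal) (X' := fun z => V (next z.1.1 z.2 z.1.2).toReal)
    (D := fun x a => 2 * cInner c (x.1.toReal - Y x.1) (a.toReal - x.2.toReal) + (1 + J))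
    (δ := 2 * δ) (C := 1 + J + 2 * √J) (K := 1 + J + 2 * K)
    (measurable_of_countable _) (measurable_of_countable _) (fun x => measurable_of_countable _)
    (fun x => hV _) (fun z => hV _) ?_ (by positivity) (by positivity) ?_ ?_ ?_
  · obtain ⟨h1, h2⟩ := key
    have h3 := hfst.map_eq
    constructor
    · rw [← h3]
      exact (integrable_map_measure hm.aestronglyMeasurable hfst.measurable.aemeasurable).2 h1
    · rw [← h3, integral_map hfst.measurable.aemeasurable hm.aestronglyMeasurable]
      exact h2
  · refine ⟨(measurable_of_countable _).aemeasurable, (measurable_of_countable _).aemeasurable, ?_⟩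
    have e1 := Measure.map_map (μ := slotLaw c α π) hm (measurePreserving_next h).measurable
    have e2 := Measure.map_map (μ := (stateLaw c π).toMeasure) hm hfst.measurable
    rw [(measurePreserving_next h).map_eq] at e1
    rw [hfst.map_eq] at e2
    exact e1.symm.trans e2
  · filter_upwards [ae_stateLaw c π] with x hx
    filter_upwards [ae_le_arrivalLaw hb] with a ha
    have h1 := hVY x.1 (next x.1 a x.2).toReal
    have h2 := cNormSq_next_sub_le hc (hY x.1) x.1 a x.2
    have h3 := cNormSq_arrivals_sub_le hc ha (mem_schedules_of_mem_maxWeight hx)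
    have h4 := hYV x.1
    linarith
  · filter_upwards [ae_stateLaw c π] with x hx
    filter_upwards [ae_le_arrivalLaw hb] with a ha
    have h3 := cNormSq_arrivals_sub_le hc ha (mem_schedules_of_mem_maxWeight hx)
    have h5 := abs_cInner_le hc (x.1.toReal - Y x.1) (a.toReal - x.2.toReal)
    have h6 : √(cNormSq c (x.1.toReal - Y x.1)) ≤ √(V x.1.toReal) + 1 :=
      (Real.sqrt_le_sqrt (hYV x.1)).trans (sqrt_add_one_le (hV _))
    have h7 : √(cNormSq c (a.toReal - x.2.toReal)) ≤ √J := Real.sqrt_le_sqrt h3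
    have h8 := mul_le_mul h6 h7 (Real.sqrt_nonneg _) (by positivity)
    have h9 : 1 + J ≤ (1 + J) * (√(V x.1.toReal) + 1) :=
      le_mul_of_one_le_right (by positivity) (by linarith [Real.sqrt_nonneg (V x.1.toReal)])
    refine (abs_add_le _ _).trans ?_
    rw [abs_mul, abs_two, abs_of_nonneg (by positivity : 0 ≤ 1 + J)]
    linarith
  · filter_upwards [ae_stateLaw c π] with x hx
    rw [integral_add (integrable_arrivalLaw hb _) (integrable_const _), integral_const_mul,
      integral_cInner_sub hb]
    simp only [integral_const, probReal_univ, one_smul]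
    linarith [hdrift x.1 x.2 hx]

/-- Below capacity the queue lengths have finite second moments in steady state. -/
theorem integrable_cNormSq (hc : ∀ p, 0 < c p) (hν : ν ∈ face c) (hpos : ∀ p, 0 < ν p)
    (h : IsSteadyState c α π) (hb : ∀ p, ∀ k ∈ (α p).support, k ≤ Amax) {ε : ℝ}
    (hε : ε ∈ Ioo (0 : ℝ) 1) (hmean : ∀ p, mean (α p) = (1 - ε) * ν p) :
    Integrable (fun q : IVec n => cNormSq c q.toReal) π.toMeasure := by
  obtain ⟨κ, hκ, hκν⟩ := exists_mul_sqrt_cNormSq_le hc hpos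
  refine (integral_le_of_comparison hc h hb (V := cNormSq c) (cNormSq_nonneg hc)
    (Y := fun _ => 0) (fun _ _ => le_rfl) (fun _ x => by rw [sub_zero])
    (fun q => by rw [sub_zero]; linarith) (δ := ε * κ) (K := 0) (mul_pos hε.1 hκ) le_rfl
    fun q s hs => ?_).1
  have h1 : (fun p => mean (α p)) = (1 - ε) • ν := funext hmean
  have h2 := cInner_le_of_mem_maxWeight hc hs hν
  have h3 := mul_le_mul_of_nonneg_left (hκν q.toReal fun p => Nat.cast_nonneg _) hε.1.le
  rw [sub_zero, cInner_sub_right, h1, cInner_smul_right]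
  linarith

/-- State-space collapse: near saturation, the mean squared distance of the queue vector to the
cone `coneK c` is bounded uniformly in the load. -/
theorem exists_integral_coneDist_le (hc : ∀ p, 0 < c p) (hν : ν ∈ face c) (hpos : ∀ p, 0 < ν p)
    (Amax : ℕ) :
    ∃ ε₀ > 0, ∃ B : ℝ, ∀ (α : Fin n × Fin n → PMF ℕ) (π : PMF (IVec n)) (ε : ℝ),
      IsSteadyState c α π → (∀ p, ∀ k ∈ (α p).support, k ≤ Amax) → ε ∈ Ioo 0 ε₀ →
      (∀ p, mean (α p) = (1 - ε) * ν p) →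
      Integrable (fun q : IVec n => coneDist c q.toReal) π.toMeasure ∧
        ∫ q : IVec n, coneDist c q.toReal ∂π.toMeasure ≤ B := by
  obtain ⟨τ, hτ, hτs⟩ := exists_cInner_sub_le hc hν hpos
  obtain ⟨L, hL, hLx⟩ := exists_coneDist_le hc
  choose Y hYK hY using fun q : IVec n => exists_cNormSq_lt (c := c) q.toReal
  have hL' : 0 < √L := Real.sqrt_pos.2 hL
  set N := √(cNormSq c ν)
  have hN : 0 ≤ N := Real.sqrt_nonneg _
  -- half of the gain `τ / √L` of MaxWeight absorbs the error due to the mean lying off the face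
  set δ := τ / √L / 2 with hδ
  have hδ0 : 0 < δ := by positivity
  refine ⟨δ / (N + 1), by positivity, _, fun α π ε h hb hε hmean =>
    integral_le_of_comparison hc h hb (V := coneDist c) (coneDist_nonneg hc) (Y := Y)
      (fun q => (hYK q).2) (fun q x => coneDist_le hc x (hYK q)) (fun q => (hY q).le)
      (δ := δ) (K := δ) hδ0 hδ0.le fun q s hs => ?_⟩
  have h1 : (fun p => mean (α p)) - s.toReal = (ν - s.toReal) - ε • ν := by
    funext p
    simp only [Pi.sub_apply, Pi.smul_apply, smul_eq_mul, hmean]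
    ring
  have h2 : cInner c (Y q) (ν - s.toReal) = 0 := by
    rw [cInner_comm, cInner_sub_left, cInner_eq_of_mem_face hc hν
      (toReal_mem_face hc (mem_schedules_of_mem_maxWeight hs)) (hYK q).1, sub_self]
  have h3 := hτs q s hs
  set v := √(coneDist c q.toReal)
  set w := √(cNormSq c (q.toReal - cProj c hc q.toReal))
  have hv : 0 ≤ v := Real.sqrt_nonneg _
  have h4 : v ≤ √L * w := by
    rw [← Real.sqrt_mul hL.le]
    exact Real.sqrt_le_sqrt (hLx _ fun p => Nat.cast_nonneg _)
  have h5 : 2 * δ * v ≤ τ * w := by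
    calc 2 * δ * v ≤ 2 * δ * (√L * w) := mul_le_mul_of_nonneg_left h4 (by positivity)
      _ = τ * w := by rw [hδ]; field_simp
  have h6 : |cInner c (q.toReal - Y q) ν| ≤ (v + 1) * N :=
    (abs_cInner_le hc _ _).trans (mul_le_mul_of_nonneg_right
      ((Real.sqrt_le_sqrt (hY q).le).trans (sqrt_add_one_le (coneDist_nonneg hc _))) hN)
  have h7 : ε * N ≤ δ := by
    have := (lt_div_iff₀ (by positivity)).1 hε.2
    nlinarith [hε.1]
  have h8 : ε * |cInner c (q.toReal - Y q) ν| ≤ (v + 1) * δ :=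
    (mul_le_mul_of_nonneg_left h6 hε.1.le).trans (by
      calc ε * ((v + 1) * N) = (v + 1) * (ε * N) := by ring
        _ ≤ (v + 1) * δ := mul_le_mul_of_nonneg_left h7 (by positivity))
  have h9 : -(ε * |cInner c (q.toReal - Y q) ν|) ≤ ε * cInner c (q.toReal - Y q) ν := by
    rw [← mul_neg]
    exact mul_le_mul_of_nonneg_left (neg_abs_le _) hε.1.le
  rw [h1, cInner_sub_right, cInner_smul_right, cInner_sub_left, h2]
  linarith

/-! ### The drift of the projected queue vector -/

theorem cProj_eq_of_mem_face (hc : ∀ p, 0 < c p) {x y : Vec n} (hx : x ∈ face c)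
    (hy : y ∈ face c) : cProj c hc x = cProj c hc y :=
  cProj_unique hc (cProj_mem hc y) fun z hz => by
    rw [cInner_sub_left, cInner_cProj_left hc y hz, cInner_eq_of_mem_face hc hx hy hz, sub_self]

theorem cNormSq_unused_le (hc : ∀ p, 0 < c p) {q a s : IVec n} (hs : s ∈ schedules n) :
    cNormSq c (unused q a s).toReal ≤ (∑ p, c p) * ∑ p, (unused q a s p : ℝ) := by
  rw [cNormSq_eq_sum, Finset.mul_sum]
  refine Finset.sum_le_sum fun p _ => ?_
  have h1 : unused q a s p ≤ 1 := by
    have := le_one_of_mem_schedules hs p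
    simp only [unused]
    omega
  have h2 : (unused q a s p : ℝ) ≤ 1 := by exact_mod_cast h1
  have h3 : (0 : ℝ) ≤ unused q a s p := Nat.cast_nonneg _
  have h4 : c p ≤ ∑ p, c p :=
    Finset.single_le_sum (f := c) (fun p _ => (hc p).le) (Finset.mem_univ p)
  simp only [IVec.toReal]
  calc c p * (unused q a s p : ℝ) ^ 2 ≤ c p * (unused q a s p : ℝ) :=
        mul_le_mul_of_nonneg_left (by nlinarith) (hc p).le
    _ ≤ _ := mul_le_mul_of_nonneg_right h4 h3

theorem sum_unused {q a s : IVec n} (hs : s ∈ schedules n) :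
    ∑ p, (unused q a s p : ℝ) =
      ∑ p, (next q a s p : ℝ) - ∑ p, (q p : ℝ) - ∑ p, (a p : ℝ) + n := by
  have h1 : ∑ p, (s p : ℝ) = n := by
    simp only [schedules, Finset.mem_filter] at hs
    have : ∑ p, s p = n := by
      rw [Fintype.sum_prod_type, Finset.sum_congr rfl fun i _ => hs.2.1 i]
      simp
    exact_mod_cast this
  rw [← h1, ← Finset.sum_sub_distrib, ← Finset.sum_sub_distrib, ← Finset.sum_add_distrib]
  refine Finset.sum_congr rfl fun p _ => ?_
  have h : ((next q a s p : ℕ) : ℝ) + s p = q p + a p + unused q a s p := by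
    exact_mod_cast next_add q a s p
  linarith

/-- The one-step change of the squared length of the projected queue vector, up to error terms that
are controlled by the distance to the cone and by the unused service. The mean arrival vector is
`(1 - ε) ν`; the inner product of the projected queue vector with `ν` is the one with any other
point `b` of the face. -/
theorem abs_drift_cProj_le (hc : ∀ p, 0 < c p) {b : Vec n} (hν : ν ∈ face c) (hb : b ∈ face c)
    {q a s : IVec n} (hs : s ∈ schedules n) {ε t : ℝ} (hε : 0 < ε) (ht : 0 < t) :
    |cNormSq c (cProj c hc q.toReal) - cNormSq c (cProj c hc (next q a s).toReal) +
        2 * cInner c (cProj c hc q.toReal - ε • cProj c hc ν) (a.toReal - (1 - ε) • ν) -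
        2 * ε * cInner c q.toReal b + cNormSq c (cProj c hc (a.toReal - (1 - ε) • ν))| ≤
      ε ^ 2 * cNormSq c ν + t * coneDist c (next q a s).toReal +
        (1 / t + 1) * ((∑ p, c p) * ∑ p, (unused q a s p : ℝ)) +
        ε * (coneDist c q.toReal + cNormSq c b) := by
  set x := q.toReal
  set x' := (next q a s).toReal with hx'
  set u := (unused q a s).toReal
  set d := a.toReal - (1 - ε) • ν with hd
  have e1 : x' = x + d - ε • ν + (ν - s.toReal) + u := by
    rw [hx', toReal_next, hd, sub_smul, one_smul]
    abel
  have e2 : cProj c hc (ν - s.toReal) = 0 := by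
    rw [cProj_sub, cProj_eq_of_mem_face hc hν (toReal_mem_face hc hs), sub_self]
  have e3 : cProj c hc x' - cProj c hc u =
      cProj c hc x + (cProj c hc d - ε • cProj c hc ν) := by
    rw [e1, cProj_add, cProj_add, e2, cProj_sub, cProj_add, cProj_smul]
    abel
  have e4 := congrArg (cNormSq c) e3
  rw [cNormSq_sub, cNormSq_add, cNormSq_sub, cInner_sub_right, cInner_smul_right,
    cInner_smul_right, cNormSq_smul] at e4
  have f1 : cInner c (cProj c hc x') (cProj c hc u) = -cInner c (x' - cProj c hc x') u := by
    rw [cInner_comm, cInner_cProj_left hc _ (cProj_mem hc _), cInner_comm, cInner_sub_left,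
      cInner_next_unused]
    ring
  have f2 : cInner c (cProj c hc x) (cProj c hc d) = cInner c (cProj c hc x) d := by
    rw [cInner_comm, cInner_cProj_left hc _ (cProj_mem hc _), cInner_comm]
  have f3 : cInner c (cProj c hc x) (cProj c hc ν) =
      cInner c x b - cInner c (x - cProj c hc x) b := by
    rw [cInner_comm, cInner_cProj_left hc _ (cProj_mem hc _),
      cInner_eq_of_mem_face hc hν hb (cProj_mem hc _), cInner_comm, cInner_sub_left]
    ring
  have f4 : cInner c (cProj c hc d) (cProj c hc ν) = cInner c (cProj c hc ν) d := by
    rw [cInner_cProj_left hc _ (cProj_mem hc _), cInner_comm]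
  rw [f1, f2, f3, f4] at e4
  have g1 := two_mul_abs_cInner_le hc (x' - cProj c hc x') u ht
  have g2 := two_mul_abs_cInner_le hc (x - cProj c hc x) b one_pos
  have g3 := mul_le_mul_of_nonneg_left (cNormSq_sub_cProj_le_coneDist hc x') ht.le
  have g4 := cNormSq_sub_cProj_le_coneDist hc x
  have g5 := cNormSq_cProj_le hc u
  have g6 := cNormSq_cProj_le hc ν
  have g7 := mul_le_mul_of_nonneg_left (cNormSq_unused_le (q := q) (a := a) hc hs)
    (by positivity : 0 ≤ 1 / t + 1)
  have g8 : (1 / t + 1) * cNormSq c u = cNormSq c u / t + cNormSq c u := by ring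
  have g9 := cNormSq_nonneg hc (cProj c hc u)
  have g10 := cNormSq_nonneg hc (cProj c hc ν)
  have g11 : ε * (2 * |cInner c (x - cProj c hc x) b|) ≤ ε * (coneDist c x + cNormSq c b) :=
    mul_le_mul_of_nonneg_left (by linarith) hε.le
  have g12 := mul_le_mul_of_nonneg_left g6 (sq_nonneg ε)
  have e5 : cNormSq c (cProj c hc x) - cNormSq c (cProj c hc x') +
      2 * cInner c (cProj c hc x - ε • cProj c hc ν) d - 2 * ε * cInner c x b +
      cNormSq c (cProj c hc d) =
      (2 * cInner c (x' - cProj c hc x') u + cNormSq c (cProj c hc u)) -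
      (ε * (2 * cInner c (x - cProj c hc x) b) + ε ^ 2 * cNormSq c (cProj c hc ν)) := by
    rw [cInner_sub_left, cInner_smul_left]
    linarith
  rw [e5]
  have k1 : |2 * cInner c (x' - cProj c hc x') u + cNormSq c (cProj c hc u)| ≤
      2 * |cInner c (x' - cProj c hc x') u| + cNormSq c (cProj c hc u) := by
    refine (abs_add_le _ _).trans (le_of_eq ?_)
    rw [abs_mul, abs_two, abs_of_nonneg g9]
  have k2 : |ε * (2 * cInner c (x - cProj c hc x) b) + ε ^ 2 * cNormSq c (cProj c hc ν)| ≤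
      ε * (2 * |cInner c (x - cProj c hc x) b|) + ε ^ 2 * cNormSq c (cProj c hc ν) := by
    refine (abs_add_le _ _).trans (le_of_eq ?_)
    rw [abs_mul, abs_mul, abs_two, abs_of_pos hε, abs_of_nonneg (mul_nonneg (sq_nonneg ε) g10)]
  have k3 := abs_sub (2 * cInner c (x' - cProj c hc x') u + cNormSq c (cProj c hc u))
    (ε * (2 * cInner c (x - cProj c hc x) b) + ε ^ 2 * cNormSq c (cProj c hc ν))
  linarith

/-! ### Taking steady-state means -/

theorem cost_le_cNormSq (hc : ∀ p, 0 < c p) (q : IVec n) : cost c q ≤ cNormSq c q.toReal := by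
  rw [cNormSq_eq_sum]
  refine Finset.sum_le_sum fun p _ => mul_le_mul_of_nonneg_left ?_ (hc p).le
  have h : q p ≤ q p ^ 2 := Nat.le_self_pow two_ne_zero _
  simp only [IVec.toReal]
  exact_mod_cast h

theorem integrable_cost (hc : ∀ p, 0 < c p)
    (h2 : Integrable (fun q : IVec n => cNormSq c q.toReal) π.toMeasure) :
    Integrable (cost c) π.toMeasure := by
  refine h2.mono' (measurable_of_countable _).aestronglyMeasurable
    (Eventually.of_forall fun q => ?_)
  have h0 : 0 ≤ cost c q :=
    Finset.sum_nonneg fun p _ => mul_nonneg (hc p).le (Nat.cast_nonneg _)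
  rw [Real.norm_of_nonneg h0]
  exact cost_le_cNormSq hc q

/-- A vector-valued function of the queue lengths with integrable squared norm has integrable
coordinates. -/
theorem integrable_apply_of_cNormSq (hc : ∀ p, 0 < c p) {f : IVec n → Vec n}
    (hf : Integrable (fun q => cNormSq c (f q)) π.toMeasure) (p : Fin n × Fin n) :
    Integrable (fun q => f q p) π.toMeasure := by
  refine ((integrable_const (1 : ℝ)).add (hf.const_mul (c p)⁻¹)).mono'
    (measurable_of_countable _).aestronglyMeasurable (Eventually.of_forall fun q => ?_)
  have h1 : f q p ^ 2 ≤ (c p)⁻¹ * cNormSq c (f q) := by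
    rw [inv_mul_eq_div, le_div_iff₀ (hc p), mul_comm]
    exact mul_sq_le_cNormSq hc (f q) p
  simp only [Pi.add_apply, Real.norm_eq_abs]
  refine le_trans ?_ (add_le_add_right h1 1)
  nlinarith [sq_abs (f q p), sq_nonneg (|f q p| - 1)]

/-- Functions of the queue lengths are uncorrelated with the arrivals of the slot. -/
theorem integral_cInner_centered (hc : ∀ p, 0 < c p)
    (hb : ∀ p, ∀ k ∈ (α p).support, k ≤ Amax) {f : IVec n → Vec n}
    (hf : Integrable (fun q => cNormSq c (f q)) π.toMeasure) :
    Integrable (fun z : (IVec n × IVec n) × IVec n =>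
      cInner c (f z.1.1) (z.2.toReal - fun p => mean (α p))) (slotLaw c α π) ∧
    ∫ z, cInner c (f z.1.1) (z.2.toReal - fun p => mean (α p)) ∂slotLaw c α π = 0 := by
  have hfst : MeasurePreserving (Prod.fst : IVec n × IVec n → IVec n) (stateLaw c π).toMeasure
      π.toMeasure := ⟨measurable_fst, map_fst_stateLaw c π⟩
  have h1 : ∀ p, Integrable (fun x : IVec n × IVec n => c p * f x.1 p)
      (stateLaw c π).toMeasure := fun p =>
    (hfst.integrable_comp_of_integrable (integrable_apply_of_cNormSq hc hf p)).const_mul _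
  have h2 : ∀ p, Integrable (fun z : (IVec n × IVec n) × IVec n =>
      c p * f z.1.1 p * ((z.2 p : ℝ) - mean (α p))) (slotLaw c α π) := fun p =>
    (h1 p).mul_prod (integrable_arrivalLaw hb fun a => (a p : ℝ) - mean (α p))
  simp only [cInner, Pi.sub_apply, IVec.toReal]
  refine ⟨integrable_finsetSum _ fun p _ => h2 p, ?_⟩
  rw [integral_finsetSum _ fun p _ => h2 p]
  refine Finset.sum_eq_zero fun p _ => ?_
  rw [integral_prod_mul (fun x : IVec n × IVec n => c p * f x.1 p)
    (fun a : IVec n => (a p : ℝ) - mean (α p)), integral_centered hb, mul_zero]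

theorem integrable_arrivals (hb : ∀ p, ∀ k ∈ (α p).support, k ≤ Amax) (f : IVec n → ℝ) :
    Integrable (fun z : (IVec n × IVec n) × IVec n => f z.2) (slotLaw c α π) :=
  measurePreserving_snd.integrable_comp_of_integrable (integrable_arrivalLaw hb f)

theorem integral_arrivals (f : IVec n → ℝ) :
    ∫ z, f z.2 ∂slotLaw c α π = ∫ a, f a ∂arrivalLaw α := by
  rw [integral_fun_snd]
  simp

/-- In steady state, departures balance arrivals: the mean unused service is `ε n`. -/
theorem integral_sum_unused (hc : ∀ p, 0 < c p) (hν : ν ∈ face c) (h : IsSteadyState c α π)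
    (hb : ∀ p, ∀ k ∈ (α p).support, k ≤ Amax) {ε : ℝ} (hmean : ∀ p, mean (α p) = (1 - ε) * ν p)
    (h2 : Integrable (fun q : IVec n => cNormSq c q.toReal) π.toMeasure) :
    Integrable (fun z : (IVec n × IVec n) × IVec n => ∑ p, (unused z.1.1 z.2 z.1.2 p : ℝ))
      (slotLaw c α π) ∧
    ∫ z, ∑ p, (unused z.1.1 z.2 z.1.2 p : ℝ) ∂slotLaw c α π = ε * n := by
  have hs : Integrable (fun q : IVec n => ∑ p, (q p : ℝ)) π.toMeasure :=
    integrable_finsetSum _ fun p _ => integrable_apply_of_cNormSq hc h2 p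
  have i1 := integrable_next h hs
  have i2 : Integrable (fun z : (IVec n × IVec n) × IVec n => ∑ p, (z.1.1 p : ℝ))
    (slotLaw c α π) := integrable_queue hs
  have i3 : Integrable (fun z : (IVec n × IVec n) × IVec n => ∑ p, (z.2 p : ℝ))
    (slotLaw c α π) := integrable_arrivals hb fun a => ∑ p, (a p : ℝ)
  have hae : (fun z : (IVec n × IVec n) × IVec n => ∑ p, (unused z.1.1 z.2 z.1.2 p : ℝ))
      =ᵐ[slotLaw c α π] fun z => ∑ p, (next z.1.1 z.2 z.1.2 p : ℝ) - ∑ p, (z.1.1 p : ℝ) -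
        ∑ p, (z.2 p : ℝ) + n := by
    filter_upwards [ae_slotLaw hb] with z hz
    exact sum_unused (mem_schedules_of_mem_maxWeight hz.1)
  have i4 := i1.sub' i2
  have i5 := i4.sub' i3
  refine ⟨(integrable_congr hae).2 (i5.fun_add (integrable_const _)), ?_⟩
  rw [integral_congr_ae hae, integral_add i5 (integrable_const _), integral_sub i4 i3,
    integral_sub i1 i2, integral_next h fun q => ∑ p, (q p : ℝ),
    integral_queue fun q => ∑ p, (q p : ℝ), integral_arrivals fun a => ∑ p, (a p : ℝ),
    integral_finsetSum _ fun p _ => integrable_arrivalLaw hb _]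
  have h3 : ∀ p, ∫ a, (a p : ℝ) ∂arrivalLaw α = (1 - ε) * ν p := fun p => by
    rw [integral_eval (fun k => (k : ℝ)) p, ← hmean]
    rfl
  have h4 : ∑ p, ν p = n := by
    rw [Fintype.sum_prod_type, Finset.sum_congr rfl fun i _ => ((mem_face_iff hc).1 hν).2.1 i]
    simp
  simp only [h3, ← Finset.mul_sum, h4]
  simp
  ring

/-- The heavy-traffic estimate for one switch: setting the steady-state drift of
`‖Q_{∥ S_c}‖_c²` to zero determines `ε E[cost]` up to an error of order `√ε`, if the mean squared
distance to the cone is at most `B`. -/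
theorem abs_sum_var_sub_le (hc : ∀ p, 0 < c p) (hn : n ≠ 0) (hν : ν ∈ face c)
    (h : IsSteadyState c α π) (hb : ∀ p, ∀ k ∈ (α p).support, k ≤ Amax) {ε B : ℝ} (hε : 0 < ε)
    (hmean : ∀ p, mean (α p) = (1 - ε) * ν p)
    (h2 : Integrable (fun q : IVec n => cNormSq c q.toReal) π.toMeasure)
    (hW : Integrable (fun q : IVec n => coneDist c q.toReal) π.toMeasure)
    (hB : ∫ q : IVec n, coneDist c q.toReal ∂π.toMeasure ≤ B) :
    |∑ p, var (α p) * zeta c hc p - 2 / n * (ε * ∫ q, cost c q ∂π.toMeasure)| ≤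
      ε ^ 2 * cNormSq c ν + √ε * B + (√ε + ε) * ((∑ p, c p) * n) +
        ε * (B + cNormSq c fun _ => (n : ℝ)⁻¹) := by
  set b : Vec n := fun _ => (n : ℝ)⁻¹ with hbdef
  have hbF : b ∈ face c := inv_mem_face hc hn
  have hm : (fun p => mean (α p)) = (1 - ε) • ν := funext hmean
  have ht : 0 < √ε := Real.sqrt_pos.2 hε
  have hcost : ∀ q : IVec n, cInner c q.toReal b = (n : ℝ)⁻¹ * cost c q := fun q => by
    rw [cInner, cost, Finset.mul_sum]
    exact Finset.sum_congr rfl fun p _ => mul_comm _ _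
  have hmeas : ∀ f : IVec n → ℝ, AEStronglyMeasurable f π.toMeasure := fun f =>
    (measurable_of_countable f).aestronglyMeasurable
  have hF : Integrable (fun q : IVec n => cNormSq c (cProj c hc q.toReal)) π.toMeasure :=
    h2.mono' (hmeas _) (Eventually.of_forall fun q => by
      rw [Real.norm_of_nonneg (cNormSq_nonneg hc _)]
      exact cNormSq_cProj_le hc _)
  have hG : Integrable (fun q : IVec n => cNormSq c (cProj c hc q.toReal - ε • cProj c hc ν))
      π.toMeasure := by
    refine ((hF.const_mul 2).add (integrable_const (2 * cNormSq c ((-ε) • cProj c hc ν)))).mono'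
      (hmeas _) (Eventually.of_forall fun q => ?_)
    rw [Real.norm_of_nonneg (cNormSq_nonneg hc _), sub_eq_add_neg, ← neg_smul]
    exact cNormSq_add_le hc _ _
  have iF : Integrable (fun z : (IVec n × IVec n) × IVec n =>
    cNormSq c (cProj c hc z.1.1.toReal)) (slotLaw c α π) := integrable_queue hF
  have iF' := integrable_next h hF
  obtain ⟨iX, hX⟩ := integral_cInner_centered (α := α) hc hb hG
  rw [hm] at iX hX
  have iC : Integrable (fun z : (IVec n × IVec n) × IVec n => cInner c z.1.1.toReal b)
      (slotLaw c α π) := by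
    simp only [hcost]
    exact (integrable_queue (integrable_cost hc h2)).const_mul _
  have iA : Integrable (fun z : (IVec n × IVec n) × IVec n =>
      cNormSq c (cProj c hc (z.2.toReal - (1 - ε) • ν))) (slotLaw c α π) :=
    integrable_arrivals hb fun a => cNormSq c (cProj c hc (a.toReal - (1 - ε) • ν))
  have iW : Integrable (fun z : (IVec n × IVec n) × IVec n => coneDist c z.1.1.toReal)
    (slotLaw c α π) := integrable_queue hW
  have iW' := integrable_next h hW
  obtain ⟨iU, hU⟩ := integral_sum_unused hc hν h hb hmean h2
  have hA : ∫ z, cNormSq c (cProj c hc (z.2.toReal - (1 - ε) • ν)) ∂slotLaw c α π =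
      ∑ p, var (α p) * zeta c hc p := by
    rw [integral_arrivals fun a => cNormSq c (cProj c hc (a.toReal - (1 - ε) • ν)), ← hm]
    exact integral_cNormSq_cProj hc hb
  have hC : ∫ z, cInner c z.1.1.toReal b ∂slotLaw c α π =
      (n : ℝ)⁻¹ * ∫ q, cost c q ∂π.toMeasure := by
    simp only [hcost]
    rw [integral_const_mul, integral_queue]
  have j1 := iF.sub' iF'
  have j2 := j1.fun_add (iX.const_mul 2)
  have j3 := j2.sub' (iC.const_mul (2 * ε))
  have hL : ∫ z, (cNormSq c (cProj c hc z.1.1.toReal) -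
        cNormSq c (cProj c hc (next z.1.1 z.2 z.1.2).toReal) +
        2 * cInner c (cProj c hc z.1.1.toReal - ε • cProj c hc ν) (z.2.toReal - (1 - ε) • ν) -
        2 * ε * cInner c z.1.1.toReal b +
        cNormSq c (cProj c hc (z.2.toReal - (1 - ε) • ν))) ∂slotLaw c α π =
      ∑ p, var (α p) * zeta c hc p - 2 / n * (ε * ∫ q, cost c q ∂π.toMeasure) := by
    rw [integral_add j3 iA, integral_sub j2 (iC.const_mul _), integral_add j1 (iX.const_mul 2),
      integral_sub iF iF', integral_const_mul, integral_const_mul, hA, hC, hX,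
      integral_next h fun q => cNormSq c (cProj c hc q.toReal),
      integral_queue fun q => cNormSq c (cProj c hc q.toReal)]
    ring
  have k1 := (integrable_const (μ := slotLaw c α π) (ε ^ 2 * cNormSq c ν)).fun_add (iW'.const_mul √ε)
  have k2 := k1.fun_add ((iU.const_mul (∑ p, c p)).const_mul (1 / √ε + 1))
  have k3 := (iW.fun_add (integrable_const (cNormSq c b))).const_mul ε
  have hR : ∫ z, (ε ^ 2 * cNormSq c ν + √ε * coneDist c (next z.1.1 z.2 z.1.2).toReal +
        (1 / √ε + 1) * ((∑ p, c p) * ∑ p, (unused z.1.1 z.2 z.1.2 p : ℝ)) +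
        ε * (coneDist c z.1.1.toReal + cNormSq c b)) ∂slotLaw c α π ≤
      ε ^ 2 * cNormSq c ν + √ε * B + (√ε + ε) * ((∑ p, c p) * n) + ε * (B + cNormSq c b) := by
    rw [integral_add k2 k3, integral_add k1 ((iU.const_mul _).const_mul _),
      integral_add (integrable_const _) (iW'.const_mul √ε), integral_const_mul √ε,
      integral_const_mul (1 / √ε + 1), integral_const_mul (∑ p, c p), integral_const_mul ε, hU,
      integral_add iW (integrable_const _), integral_next h fun q => coneDist c q.toReal,
      integral_queue fun q => coneDist c q.toReal]
    simp only [integral_const, probReal_univ, one_smul]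
    have e1 : (1 / √ε + 1) * ((∑ p, c p) * (ε * n)) = (√ε + ε) * ((∑ p, c p) * n) := by
      have e2 : ε / √ε = √ε := Real.div_sqrt
      calc _ = (ε / √ε + ε) * ((∑ p, c p) * n) := by ring
        _ = _ := by rw [e2]
    rw [e1]
    gcongr
  rw [← hL]
  refine (abs_integral_le_integral_abs).trans (le_trans ?_ hR)
  refine integral_mono_ae (j3.fun_add iA).abs (k2.fun_add k3) ?_
  filter_upwards [ae_slotLaw hb] with z hz
  exact abs_drift_cProj_le hc hν hbF (mem_schedules_of_mem_maxWeight hz.1) hε ht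

/-- The right-hand side of `abs_sum_var_sub_le` vanishes in the limit. -/
theorem tendsto_error (a b d e : ℝ) :
    Tendsto (fun ε : ℝ => ε ^ 2 * a + √ε * b + (√ε + ε) * d + ε * e) (𝓝[>] 0) (𝓝 0) := by
  have h : Continuous fun ε : ℝ => ε ^ 2 * a + √ε * b + (√ε + ε) * d + ε * e := by fun_prop
  have := h.tendsto 0
  simp only [Real.sqrt_zero] at this
  norm_num at this
  exact this.mono_left nhdsWithin_le_nhds

end InputQueuedSwitch

open InputQueuedSwitch in
theorem theorem1 (n : ℕ) (c : InputQueuedSwitch.Vec n) (hc : ∀ p, 0 < c p)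
    (ν : InputQueuedSwitch.Vec n) (Amax : ℕ) (A : ℝ → Fin n × Fin n → PMF ℕ)
    (σ2 : InputQueuedSwitch.Vec n) (hA : InputQueuedSwitch.IsBaseFamily c ν Amax A σ2)
    (Q : ℝ → PMF (InputQueuedSwitch.IVec n))
    (hQ : ∀ ε ∈ Set.Ioo (0 : ℝ) 1, InputQueuedSwitch.IsSteadyState c (A ε) (Q ε)) :
    (∀ ε ∈ Set.Ioo (0 : ℝ) 1,
      MeasureTheory.Integrable (InputQueuedSwitch.cost c) (Q ε).toMeasure) ∧
    Filter.Tendsto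
      (fun ε : ℝ => ε * ∫ q, InputQueuedSwitch.cost c q ∂(Q ε).toMeasure)
      (nhdsWithin 0 (Set.Ioi 0))
      (nhds ((n : ℝ) / 2 * ∑ p, σ2 p * InputQueuedSwitch.zeta c hc p)) := by
  have hpos := pos_of_mem_intrinsicInterior hc hA.mem_face
  have hν : ν ∈ face c := intrinsicInterior_subset hA.mem_face
  have hsq : ∀ ε ∈ Set.Ioo (0 : ℝ) 1,
      Integrable (fun q : IVec n => cNormSq c q.toReal) (Q ε).toMeasure := fun ε hε =>
    integrable_cNormSq hc hν hpos (hQ ε hε) (hA.bounded ε hε) hε (hA.mean_eq ε hε)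
  refine ⟨fun ε hε => integrable_cost hc (hsq ε hε), ?_⟩
  obtain rfl | hn := eq_or_ne n 0
  · simp [cost]
  obtain ⟨ε₀, hε₀, B, hB⟩ := exists_integral_coneDist_le hc hν hpos Amax
  have hdiff : Tendsto (fun ε => ∑ p, var (A ε p) * zeta c hc p -
      2 / n * (ε * ∫ q, cost c q ∂(Q ε).toMeasure)) (𝓝[>] 0) (𝓝 0) := by
    refine squeeze_zero_norm' ?_ (tendsto_error (cNormSq c ν) B ((∑ p, c p) * n)
      (B + cNormSq c fun _ => (n : ℝ)⁻¹))
    filter_upwards [Ioo_mem_nhdsGT (lt_min one_pos hε₀)] with ε hε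
    have h1 : ε ∈ Ioo (0 : ℝ) 1 := ⟨hε.1, hε.2.trans_le (min_le_left _ _)⟩
    obtain ⟨hW, hWB⟩ := hB (A ε) (Q ε) ε (hQ ε h1) (hA.bounded ε h1)
      ⟨hε.1, hε.2.trans_le (min_le_right _ _)⟩ (hA.mean_eq ε h1)
    exact abs_sum_var_sub_le hc hn hν (hQ ε h1) (hA.bounded ε h1) h1.1 (hA.mean_eq ε h1)
      (hsq ε h1) hW hWB
  have hvar : Tendsto (fun ε => ∑ p, var (A ε p) * zeta c hc p) (𝓝[>] 0)
      (𝓝 (∑ p, σ2 p * zeta c hc p)) :=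
    tendsto_finsetSum _ fun p _ => (hA.var_tendsto p).mul_const _
  have hlim := (hvar.sub hdiff).const_mul ((n : ℝ) / 2)
  rw [sub_zero] at hlim
  refine hlim.congr fun ε => ?_
  have hn' : (n : ℝ) ≠ 0 := Nat.cast_ne_zero.2 hn
  field_simp
  ring
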